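/- Let $n\ge 1$, $\alpha\ge 0$, $0<\zeta_1<\cdots<\zeta_n$, $b_j(0)>0$, and put $$b_j(t)=b_j(0)e^{t/\zeta_j},\qquad f_i(t)=\sum_{j=1}^n\zeta_j^{\,i}\,b_j(t)\qquad(i\in\mathbb Z,\ t\in\mathbb R).$$ For antisymmetric entries $(i,j)$, the Pfaffian is $(i_1,\dots,i_{2N})=\sum_\sigma \operatorname{sgn}(\sigma)\prod_{l=1}^N (i_{\sigma(2l-1)},i_{\sigma(2l)})$, the sum being over the permutations $\sigma$ of $\{1,\dots,2N\}$ with $\sigma(2l-1)<\sigma(2l)$ and $\sigma(2l-1)<\sigma(2l+1)$; a Pfaffian of order $0$ is $1$ and one of negative order is $0$. Take the antisymmetric entries indexed by a symbol $d_0$ and the integers $$(d_0,i)=f_i(t),\qquad (i,j)=e^{-\alpha t}\iint_{-\infty<t_1<t_2<t}e^{\alpha t_2}\bigl[f_{i-1}(t_2)f_{j-1}(t_1)-f_{i-1}(t_1)f_{j-1}(t_2)\bigr]\,dt_1\,dt_2 ,$$ and for each integer $k$ define \begin{align*} &\tilde T_{2k}=(-1,0,\dots,2k-2), &&\tilde T_{2k-1}=(d_0,-1,0,\dots,2k-3),\\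 &\tilde U_{2k}=(0,1,\dots,2k-1), &&\tilde U_{2k-1}=(d_0,0,1,\dots,2k-2),\\ &\tilde V_{2k}=(1,2,\dots,2k), &&\tilde V_{2k-1}=(d_0,1,2,\dots,2k-1), \end{align*} $$\tilde W_k=\tilde V_k\tilde U_k-\tilde V_{k-1}\tilde U_{k+1},\qquad \tilde Z_k=\tilde T_k\tilde U_k-\tilde T_{k+1}\tilde U_{k-1}.$$ Then for all $t\in\mathbb R$ and $1\le k\le n$ the quantities $\tilde Z_k,\tilde W_{k-1},\tilde U_k,\tilde U_{k-1}$ are positive, so that, with $k'=n+1-k$, $$\tilde x_{k'}=\frac12\log\frac{\tilde Z_k}{\tilde W_{k-1}},\qquad \tilde m_{k'}=\frac{\sqrt{\tilde Z_k\tilde W_{k-1}}}{\tilde U_k\tilde U_{k-1}}\qquad(k=1,\dots,n)$$ are well-defined real functions of $t\in\mathbb R$. They are differentiable and satisfy, for $k=1,\dots,n$ and all $t$, the generalized Novikov peakon system \begin{align*} \dot{\tilde x}_{k'}&=\left(\sum_{j=1}^{k-1}\tilde m_{j'}e^{\tilde x_{k'}-\tilde x_{j'}}+\sum_{j=k}^{n}\tilde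 m_{j'}e^{\tilde x_{j'}-\tilde x_{k'}}\right)^2+\frac{\alpha}{2\tilde m_{k'}}\left(\sum_{j=1}^{k-1}\tilde m_{j'}e^{\tilde x_{k'}-\tilde x_{j'}}+\sum_{j=k}^{n}\tilde m_{j'}e^{\tilde x_{j'}-\tilde x_{k'}}\right)-\frac{\alpha}{2},\\ \dot{\tilde m}_{k'}&=\tilde m_{k'}\left(\sum_{j=1}^{k-1}\tilde m_{j'}e^{\tilde x_{k'}-\tilde x_{j'}}+\sum_{j=k}^{n}\tilde m_{j'}e^{\tilde x_{j'}-\tilde x_{k'}}\right)\left(\sum_{j=k+1}^{n}\tilde m_{j'}e^{\tilde x_{j'}-\tilde x_{k'}}-\sum_{j=1}^{k-1}\tilde m_{j'}e^{\tilde x_{k'}-\tilde x_{j'}}\right)\\ &\quad+\frac{\alpha}{2}\left(\sum_{j=k+1}^{n}\tilde m_{j'}e^{\tilde x_{j'}-\tilde x_{k'}}-\sum_{j=1}^{k-1}\tilde m_{j'}e^{\tilde x_{k'}-\tilde x_{j'}}\right). \end{align*} -/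

import Mathlib

namespace GenNovikov

/-- The Pfaffian `Pf(1,2,…,2N)` of a square array of entries: the sum over all pairings
`(i₁,i₂), …, (i_{2N-1},i_{2N})` of the indices, normalised by `i_{2l-1} < i_{2l}` and
`i₁ < i₃ < i₅ < …`, of the sign of the permutation `i₁,…,i_{2N}` times the product of the
entries at the pairs.  For `N = 0` it is `1`. -/
noncomputable def pfaffian (N : ℕ) (a : Fin (2 * N) → Fin (2 * N) → ℝ) : ℝ :=
  open Classical in
  ∑ σ ∈ (Finset.univ : Finset (Equiv.Perm (Fin (2 * N)))).filter (fun σ =>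
      (∀ l : Fin N, σ ⟨2 * l.1, by have := l.2; omega⟩ < σ ⟨2 * l.1 + 1, by have := l.2; omega⟩) ∧
      (∀ l l' : Fin N, l < l' →
        σ ⟨2 * l.1, by have := l.2; omega⟩ < σ ⟨2 * l'.1, by have := l'.2; omega⟩)),
    ((Equiv.Perm.sign σ : ℤ) : ℝ) *
      ∏ l : Fin N, a (σ ⟨2 * l.1, by have := l.2; omega⟩) (σ ⟨2 * l.1 + 1, by have := l.2; omega⟩)

/-- The functions `b_j(t) = b_j(0) e^{t/ζ_j}`; the argument `b₀` lists the values `b_j(0)`. -/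
noncomputable def bFun {n : ℕ} (ζ b₀ : Fin n → ℝ) (j : Fin n) (t : ℝ) : ℝ :=
  b₀ j * Real.exp (t / ζ j)

/-- The functions `f_i(t) = ∑_j ζ_j^i b_j(t)`, for an integer `i`. -/
noncomputable def fFun {n : ℕ} (ζ b₀ : Fin n → ℝ) (i : ℤ) (t : ℝ) : ℝ :=
  ∑ j, ζ j ^ i * bFun ζ b₀ j t

/-- The symbols that index the rows of the Pfaffians: the letter `d₀` and the integers. -/
inductive Label : Type
  | d0 : Label
  | num (i : ℤ) : Label

/-- The (antisymmetric) Pfaffian entries: `(d₀,i) = f_i(t)` and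
`(i,j) = e^{-αt} ∬_{t₁<t₂<t} e^{αt₂} [f_{i-1}(t₂) f_{j-1}(t₁) - f_{i-1}(t₁) f_{j-1}(t₂)] dt₁ dt₂`. -/
noncomputable def entry {n : ℕ} (α : ℝ) (ζ b₀ : Fin n → ℝ) (t : ℝ) : Label → Label → ℝ
  | .d0, .d0 => 0
  | .d0, .num i => fFun ζ b₀ i t
  | .num i, .d0 => -fFun ζ b₀ i t
  | .num i, .num j =>
      Real.exp (-(α * t)) *
        ∫ p in {p : ℝ × ℝ | p.1 < p.2 ∧ p.2 < t},
          Real.exp (α * p.2) *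
            (fFun ζ b₀ (i - 1) p.2 * fFun ζ b₀ (j - 1) p.1
              - fFun ζ b₀ (i - 1) p.1 * fFun ζ b₀ (j - 1) p.2)

/-- The sequence of symbols `l, l+1, l+2, …`. -/
def labelsEven (l : ℤ) (r : ℕ) : Label := .num (l + r)

/-- The sequence of symbols `d₀, l, l+1, …`. -/
def labelsOdd (l : ℤ) : ℕ → Label
  | 0 => .d0
  | r + 1 => .num (l + r)

/-- The Pfaffians with `k` consecutive integer labels starting at `l`, for any integer `k`:
`P_{2m} = (l, l+1, …, l+2m-1)` and `P_{2m-1} = (d₀, l, l+1, …, l+2m-2)`,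
with value `1` for `k = 0` and value `0` for `k < 0`. -/
noncomputable def tildeP {n : ℕ} (α : ℝ) (ζ b₀ : Fin n → ℝ) (l k : ℤ) (t : ℝ) : ℝ :=
  open Classical in
  if k < 0 then 0
  else if Even k then
    pfaffian (k.toNat / 2) (fun r s => entry α ζ b₀ t (labelsEven l r) (labelsEven l s))
  else
    pfaffian ((k.toNat + 1) / 2) (fun r s => entry α ζ b₀ t (labelsOdd l r) (labelsOdd l s))

/-- `T_{2m} = (-1, 0, …, 2m-2)`, `T_{2m-1} = (d₀, -1, 0, …, 2m-3)`. -/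
noncomputable def tildeT {n : ℕ} (α : ℝ) (ζ b₀ : Fin n → ℝ) (k : ℤ) (t : ℝ) : ℝ :=
  tildeP α ζ b₀ (-1) k t

/-- `U_{2m} = (0, 1, …, 2m-1)`, `U_{2m-1} = (d₀, 0, 1, …, 2m-2)`. -/
noncomputable def tildeU {n : ℕ} (α : ℝ) (ζ b₀ : Fin n → ℝ) (k : ℤ) (t : ℝ) : ℝ :=
  tildeP α ζ b₀ 0 k t

/-- `V_{2m} = (1, 2, …, 2m)`, `V_{2m-1} = (d₀, 1, 2, …, 2m-1)`. -/
noncomputable def tildeV {n : ℕ} (α : ℝ) (ζ b₀ : Fin n → ℝ) (k : ℤ) (t : ℝ) : ℝ :=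
  tildeP α ζ b₀ 1 k t

/-- `W_k = V_k U_k - V_{k-1} U_{k+1}`. -/
noncomputable def tildeW {n : ℕ} (α : ℝ) (ζ b₀ : Fin n → ℝ) (k : ℤ) (t : ℝ) : ℝ :=
  tildeV α ζ b₀ k t * tildeU α ζ b₀ k t - tildeV α ζ b₀ (k - 1) t * tildeU α ζ b₀ (k + 1) t

/-- `Z_k = T_k U_k - T_{k+1} U_{k-1}`. -/
noncomputable def tildeZ {n : ℕ} (α : ℝ) (ζ b₀ : Fin n → ℝ) (k : ℤ) (t : ℝ) : ℝ :=
  tildeT α ζ b₀ k t * tildeU α ζ b₀ k t - tildeT α ζ b₀ (k + 1) t * tildeU α ζ b₀ (k - 1) t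

/-- `∑_{j=1}^{k-1} m_{j'} e^{x_{k'} - x_{j'}}`, where `i' = n + 1 - i`. -/
noncomputable def sumBelow (n : ℕ) (x m : ℤ → ℝ → ℝ) (k : ℤ) (t : ℝ) : ℝ :=
  ∑ j ∈ Finset.Icc (1 : ℤ) (k - 1), m (n + 1 - j) t * Real.exp (x (n + 1 - k) t - x (n + 1 - j) t)

/-- `∑_{j=i}^{n} m_{j'} e^{x_{j'} - x_{k'}}`, where `i' = n + 1 - i`. -/
noncomputable def sumFrom (n : ℕ) (x m : ℤ → ℝ → ℝ) (i k : ℤ) (t : ℝ) : ℝ :=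
  ∑ j ∈ Finset.Icc i (n : ℤ), m (n + 1 - j) t * Real.exp (x (n + 1 - j) t - x (n + 1 - k) t)

end GenNovikov

/-!
The Pfaffians in the statement are tau functions of finitely many solitons, and the theorem is a
consequence of two bilinear relations between them together with their positivity.

Write `λ_p = 1 / ζ_p` and `μ_p = λ_p + α / 2`.  Carrying out the double integral turns the entry
`(i, j)` into `∑_{p,q} ζ_p^i b_p K(p,q) ζ_q^j b_q` with the Schur kernel
`K(p,q) = (μ_p - μ_q) / (μ_p + μ_q)` (`entry_num_num`).  So every Pfaffian is the value, at a wedge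
product of vectors of a space spanned by one vector per `p` and two bordering vectors `d₀`, `d₁`, of
one linear functional on an exterior algebra (`wick`, `tildeP_eq_tau`).  In this language the
expansion along a row is contraction with a linear form, and the quadratic relations of the Pfaffian
are the antisymmetry of `Pf(ℓ_y ⌋ x)` in `x` and `y`, where `ℓ_y(v) = Pf(v ∧ y)`
(`wick_contract_rowForm`).

The row `d₁` encodes time differentiation: because `(μ_p + μ_q) K(p,q) = μ_p - μ_q`, adjoining it
multiplies the value at basis vectors `p₁, …, p_k` by `∑ μ_{p_r}` (`tauDot_wedge_pt`).  With this the
quadratic relations give Schur's evaluation of the Pfaffian of `K` (`tau_wedge_pt`) and the two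
bilinear relations for the Pfaffians `P_k(l)` with `k` integer labels from `l` on
(`tildeP_bilinear_dot`, `tildeP_bilinear_three`).  Schur's evaluation and a Vandermonde determinant
write `P_k(l)` as a sum of exponentials with positive coefficients over the `k`-element subsets of
the spectrum (`factorial_mul_tildeP`), which is positive for `k ≤ n` and zero for `k > n`.

Both `Z_k` and `W_k` are values of `P_k(l) P_k(l+1) - P_{k+1}(l) P_{k-1}(l+1)`, for `l = -1` and
`l = 0`.  This expression is positive near `t = -∞` by comparing exponents; by the bilinear relations
and induction on `k` its derivative is positive wherever it vanishes, so it never vanishes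
(`minor_pos`).  Finally `m e^{±x}` are `Z_k / (U_k U_{k-1})` and `W_{k-1} / (U_k U_{k-1})`, which are
differences of consecutive terms of `T_j / U_{j-1}` and `V_{j-2} / U_{j-1}`, so the sums in the
peakon equations telescope, and the equations become identities that follow from the bilinear
relations (`position_identity`, `mass_identity`).
-/

/-! ### Expansion of the Pfaffian along its first row -/

namespace GenNovikov

/-- The condition on a permutation `σ` that selects one representative of each perfect matching
`{σ 0, σ 1}, {σ 2, σ 3}, …`. -/
def IsMatching (N : ℕ) (σ : Equiv.Perm (Fin (2 * N))) : Prop :=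
  (∀ l : Fin N, σ ⟨2 * l.1, by have := l.2; omega⟩ < σ ⟨2 * l.1 + 1, by have := l.2; omega⟩) ∧
    (∀ l l' : Fin N, l < l' →
      σ ⟨2 * l.1, by have := l.2; omega⟩ < σ ⟨2 * l'.1, by have := l'.2; omega⟩)

/-- The permutation `0 ↦ 0`, `1 ↦ j + 1`, which on the remaining indices is `σ`, transported to the
complement of `{0, j + 1}`. -/
def adjoinPair {m : ℕ} (j : Fin (m + 1)) (σ : Equiv.Perm (Fin m)) : Equiv.Perm (Fin (m + 2)) :=
  Equiv.Perm.decomposeFin.symm (0, j.cycleRange.symm * Equiv.Perm.decomposeFin.symm (0, σ))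

lemma adjoinPair_zero {m : ℕ} (j : Fin (m + 1)) (σ : Equiv.Perm (Fin m)) :
    adjoinPair j σ 0 = 0 := by
  simp [adjoinPair]

lemma adjoinPair_one {m : ℕ} (j : Fin (m + 1)) (σ : Equiv.Perm (Fin m)) :
    adjoinPair j σ (Fin.succ 0) = j.succ := by
  rw [adjoinPair, Equiv.Perm.decomposeFin_symm_apply_succ]
  simp

lemma adjoinPair_succ_succ {m : ℕ} (j : Fin (m + 1)) (σ : Equiv.Perm (Fin m)) (r : Fin m) :
    adjoinPair j σ r.succ.succ = (j.succAbove (σ r)).succ := by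
  simp [adjoinPair]

lemma sign_adjoinPair {m : ℕ} (j : Fin (m + 1)) (σ : Equiv.Perm (Fin m)) :
    ((Equiv.Perm.sign (adjoinPair j σ) : ℤ) : ℝ) = (-1) ^ (j : ℕ) * ((Equiv.Perm.sign σ : ℤ) : ℝ) := by
  rw [adjoinPair, Equiv.Perm.decomposeFin.symm_sign, Equiv.Perm.sign_mul,
    Equiv.Perm.sign_symm, Fin.sign_cycleRange, Equiv.Perm.decomposeFin.symm_sign]
  simp

lemma adjoinPair_injective {m : ℕ} :
    Function.Injective (fun p : Fin (m + 1) × Equiv.Perm (Fin m) => adjoinPair p.1 p.2) := by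
  rintro ⟨j, σ⟩ ⟨j', σ'⟩ h
  simp only at h
  have hj : j = j' := by
    have := congrArg (fun τ => τ (Fin.succ 0)) h
    simp only [adjoinPair_one] at this
    exact Fin.succ_injective _ this
  subst hj
  have hσ : σ = σ' := by
    ext r
    have := congrArg (fun τ => τ r.succ.succ) h
    simp only [adjoinPair_succ_succ] at this
    rw [Fin.succAbove_right_injective (Fin.succ_injective _ this)]
  rw [hσ]

lemma exists_adjoinPair_eq {m : ℕ} (τ : Equiv.Perm (Fin (m + 2))) (h : τ 0 = 0) :
    ∃ j σ, adjoinPair j σ = τ := by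
  obtain ⟨⟨a, ρ⟩, rfl⟩ := Equiv.Perm.decomposeFin.symm.surjective τ
  rw [Equiv.Perm.decomposeFin_symm_apply_zero] at h
  subst h
  obtain ⟨⟨c, σ⟩, hc⟩ := Equiv.Perm.decomposeFin.symm.surjective ((ρ 0).cycleRange * ρ)
  have h0 : c = 0 := by
    have := congrArg (fun τ => τ 0) hc
    simpa using this
  subst h0
  refine ⟨ρ 0, σ, ?_⟩
  rw [adjoinPair, hc]
  congr 2
  ext r
  simp

lemma IsMatching.apply_zero {N : ℕ} {σ : Equiv.Perm (Fin (2 * N + 2))}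
    (h : IsMatching (N + 1) σ) : σ 0 = 0 := by
  obtain ⟨i, hi⟩ := σ.surjective 0
  rcases Nat.even_or_odd' i.1 with ⟨l, hl | hl⟩
  · rcases Nat.eq_zero_or_pos l with rfl | hpos
    · have : i = 0 := Fin.ext (by simpa using hl)
      exact this ▸ hi
    · have h1 := h.2 ⟨0, by omega⟩ ⟨l, by omega⟩ (by simpa [Fin.lt_def] using hpos)
      have h2 : (⟨2 * l, by omega⟩ : Fin (2 * N + 2)) = i := Fin.ext hl.symm
      have h3 : σ (⟨2 * l, by omega⟩ : Fin (2 * N + 2)) = 0 := by rw [h2, hi]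
      exact absurd (h1.trans_eq h3) (Fin.not_lt_zero _)
  · have h1 := h.1 ⟨l, by omega⟩
    have h2 : (⟨2 * l + 1, by omega⟩ : Fin (2 * N + 2)) = i := Fin.ext hl.symm
    have h3 : σ (⟨2 * l + 1, by omega⟩ : Fin (2 * N + 2)) = 0 := by rw [h2, hi]
    exact absurd (h1.trans_eq h3) (Fin.not_lt_zero _)

lemma isMatching_succ_iff {N : ℕ} (τ : Equiv.Perm (Fin (2 * N + 2))) :
    IsMatching (N + 1) τ ↔
      (τ 0 < τ (Fin.succ 0) ∧ ∀ l : Fin N, τ (Fin.succ (Fin.succ ⟨2 * l.1, by have := l.2; omega⟩)) <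
        τ (Fin.succ (Fin.succ ⟨2 * l.1 + 1, by have := l.2; omega⟩))) ∧
      (∀ l : Fin N, τ 0 < τ (Fin.succ (Fin.succ ⟨2 * l.1, by have := l.2; omega⟩))) ∧
      (∀ l l' : Fin N, l < l' → τ (Fin.succ (Fin.succ ⟨2 * l.1, by have := l.2; omega⟩)) <
        τ (Fin.succ (Fin.succ ⟨2 * l'.1, by have := l'.2; omega⟩))) := by
  constructor
  · intro h
    exact ⟨⟨h.1 0, fun l => h.1 l.succ⟩, fun l => h.2 0 l.succ (Fin.succ_pos l),
      fun l l' hl => h.2 l.succ l'.succ (Fin.succ_lt_succ_iff.2 hl)⟩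
  · rintro ⟨⟨h1, h2⟩, h3, h4⟩
    refine ⟨fun l => ?_, fun l l' => ?_⟩
    · induction l using Fin.cases with
      | zero => exact h1
      | succ l => exact h2 l
    · induction l' using Fin.cases with
      | zero => exact fun hl => absurd hl (Fin.not_lt_zero _)
      | succ l' =>
        induction l using Fin.cases with
        | zero => exact fun _ => h3 l'
        | succ l => exact fun hl => h4 l l' (Fin.succ_lt_succ_iff.1 hl)

lemma isMatching_adjoinPair {N : ℕ} (j : Fin (2 * N + 1)) (σ : Equiv.Perm (Fin (2 * N))) :
    IsMatching (N + 1) (adjoinPair j σ) ↔ IsMatching N σ := by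
  rw [isMatching_succ_iff]
  simp only [adjoinPair_succ_succ, adjoinPair_zero, adjoinPair_one, Fin.succ_lt_succ_iff,
    Fin.succAbove_lt_succAbove_iff, Fin.succ_pos, implies_true, true_and]
  rfl

lemma pfaffian_zero (a : Fin (2 * 0) → Fin (2 * 0) → ℝ) : pfaffian 0 a = 1 := by
  classical
  have : ∀ σ : Equiv.Perm (Fin (2 * 0)), σ = 1 := fun σ => Subsingleton.elim (α := Equiv.Perm (Fin 0)) σ 1
  unfold pfaffian
  rw [Finset.sum_eq_single (1 : Equiv.Perm (Fin (2 * 0)))]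
  · simp
  · exact fun σ _ h => absurd (this σ) h
  · intro h
    exact absurd (Finset.mem_filter.2 ⟨Finset.mem_univ _, fun l => l.elim0, fun l => l.elim0⟩) h

/-- Expansion of the Pfaffian along its first row. -/
theorem pfaffian_succ (N : ℕ) (a : Fin (2 * N + 2) → Fin (2 * N + 2) → ℝ) :
    pfaffian (N + 1) a = ∑ j : Fin (2 * N + 1), (-1) ^ (j : ℕ) * a 0 j.succ *
      pfaffian N (fun r s => a (j.succAbove r).succ (j.succAbove s).succ) := by
  classical
  have key : ∀ (M : ℕ) (c : Fin (2 * M) → Fin (2 * M) → ℝ), pfaffian M c =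
      ∑ σ with IsMatching M σ, ((Equiv.Perm.sign σ : ℤ) : ℝ) * ∏ l : Fin M,
        c (σ ⟨2 * l.1, by have := l.2; omega⟩) (σ ⟨2 * l.1 + 1, by have := l.2; omega⟩) := by
    intro M c
    unfold pfaffian IsMatching
    congr!
  rw [key]
  simp_rw [key N, Finset.mul_sum]
  rw [← Finset.sum_product']
  symm
  refine Finset.sum_bij (fun p _ => adjoinPair p.1 p.2) ?_ ?_ ?_ ?_
  · rintro ⟨j, σ⟩ h
    simp only [Finset.mem_product, Finset.mem_univ, true_and, Finset.mem_filter] at h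
    exact Finset.mem_filter.2 ⟨Finset.mem_univ _, (isMatching_adjoinPair j σ).2 h⟩
  · intro p _ q _ h
    exact adjoinPair_injective h
  · intro τ hτ
    have hτ' := (Finset.mem_filter.1 hτ).2
    obtain ⟨j, σ, rfl⟩ := exists_adjoinPair_eq τ hτ'.apply_zero
    exact ⟨(j, σ), Finset.mem_product.2 ⟨Finset.mem_univ _, Finset.mem_filter.2
      ⟨Finset.mem_univ _, (isMatching_adjoinPair j σ).1 hτ'⟩⟩, rfl⟩
  · rintro ⟨j, σ⟩ _
    have h : ∏ l : Fin (N + 1), a (adjoinPair j σ ⟨2 * l.1, by have := l.2; omega⟩)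
        (adjoinPair j σ ⟨2 * l.1 + 1, by have := l.2; omega⟩) = a 0 j.succ * ∏ l : Fin N,
        a (j.succAbove (σ ⟨2 * l.1, by have := l.2; omega⟩)).succ
          (j.succAbove (σ ⟨2 * l.1 + 1, by have := l.2; omega⟩)).succ := by
      rw [Fin.prod_univ_succ]
      congr 1
      · exact congrArg₂ a (adjoinPair_zero j σ).symm (adjoinPair_one j σ).symm |>.symm
      · refine Finset.prod_congr rfl fun l _ => ?_
        exact congrArg₂ a (adjoinPair_succ_succ j σ ⟨2 * l.1, by have := l.2; omega⟩)
          (adjoinPair_succ_succ j σ ⟨2 * l.1 + 1, by have := l.2; omega⟩)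
    refine Eq.trans ?_ (congrArg₂ (· * ·) (sign_adjoinPair j σ) h).symm
    dsimp only
    ring

end GenNovikov

/-! ### The Pfaffian as a functional on the exterior algebra -/

namespace GenNovikov

open ExteriorAlgebra CliffordAlgebra

section Wick

variable {V : Type*} [AddCommGroup V] [Module ℝ V] {B : LinearMap.BilinForm ℝ V}

lemma neg_toQuadraticMap_eq (hB : B.IsAlt) :
    (-B).toQuadraticMap = (0 : QuadraticForm ℝ V) - 0 := by
  ext v
  simp [hB.self_eq_zero v]

/-- The functional on the exterior algebra of `V` whose value at `v₁ ∧ ⋯ ∧ v_k` is the Pfaffian of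
the matrix `B (v_r) (v_s)` (and `0` for odd `k`).  It is the scalar part of the operator
`x ↦ λ_B x` that deforms the zero quadratic form into itself along the alternating form `B`. -/
noncomputable def wick (hB : B.IsAlt) : ExteriorAlgebra ℝ V →ₗ[ℝ] ℝ :=
  algebraMapInv.toLinearMap ∘ₗ changeForm (neg_toQuadraticMap_eq hB)

variable (hB : B.IsAlt)

lemma wick_one : wick hB 1 = 1 := by
  simp [wick]

/-- The contraction of an element of the exterior algebra with a linear form. -/
noncomputable def contract (d : Module.Dual ℝ V) : ExteriorAlgebra ℝ V →ₗ[ℝ] ExteriorAlgebra ℝ V :=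
  contractLeft d

lemma contract_ι_mul (d : Module.Dual ℝ V) (v : V) (x : ExteriorAlgebra ℝ V) :
    contract d (ExteriorAlgebra.ι ℝ v * x) =
      d v • x - ExteriorAlgebra.ι ℝ v * contract d x :=
  contractLeft_ι_mul d v x

lemma contract_one (d : Module.Dual ℝ V) : contract d (1 : ExteriorAlgebra ℝ V) = 0 :=
  contractLeft_one (0 : QuadraticForm ℝ V) d

lemma contract_comm (d d' : Module.Dual ℝ V) (x : ExteriorAlgebra ℝ V) :
    contract d (contract d' x) = -contract d' (contract d x) :=
  contractLeft_comm d d' x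

lemma contract_sum {ι' : Type*} (s : Finset ι') (d : ι' → Module.Dual ℝ V)
    (x : ExteriorAlgebra ℝ V) : contract (∑ i ∈ s, d i) x = ∑ i ∈ s, contract (d i) x := by
  unfold contract
  rw [map_sum, LinearMap.sum_apply]

lemma contract_smul (c : ℝ) (d : Module.Dual ℝ V)
    (x : ExteriorAlgebra ℝ V) : contract (c • d) x = c • contract d x := by
  unfold contract
  rw [map_smul, LinearMap.smul_apply]

/-- Row expansion, free of coordinates. -/
lemma wick_ι_mul (v : V) (x : ExteriorAlgebra ℝ V) :
    wick hB (ExteriorAlgebra.ι ℝ v * x) = wick hB (contract (B v) x) := by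
  have h1 := changeForm_ι_mul (neg_toQuadraticMap_eq hB) v x
  have h2 := changeForm_contractLeft (neg_toQuadraticMap_eq hB) (B v) x
  unfold wick contract
  simp only [LinearMap.comp_apply, AlgHom.toLinearMap_apply]
  erw [h1, h2]
  rw [map_sub, map_mul]
  have h3 : algebraMapInv (R := ℝ) (ExteriorAlgebra.ι ℝ v) = 0 := by
    simp [algebraMapInv]
  erw [h3]
  simp

lemma contract_ιMulti {k : ℕ} (d : Module.Dual ℝ V) (v : Fin (k + 1) → V) :
    contract d (ιMulti ℝ (k + 1) v) =
      ∑ j : Fin (k + 1), ((-1) ^ (j : ℕ) * d (v j)) • ιMulti ℝ k (fun r => v (j.succAbove r)) := by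
  induction k with
  | zero =>
    rw [ιMulti_succ_apply, contract_ι_mul]
    simp [contract_one]
  | succ k ih =>
    rw [ιMulti_succ_apply, contract_ι_mul, Fin.sum_univ_succ, ih, Finset.mul_sum,
      sub_eq_add_neg, ← Finset.sum_neg_distrib]
    congr 1
    · simp [Matrix.vecTail, Function.comp_def]
    · refine Finset.sum_congr rfl fun j _ => ?_
      rw [ιMulti_succ_apply (fun r => v (j.succ.succAbove r))]
      simp only [Matrix.vecTail, Function.comp_def, Fin.val_succ, pow_succ, Fin.succ_succAbove_zero,
        Fin.succ_succAbove_succ]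
      simp

theorem wick_ιMulti_succ {k : ℕ} (v : Fin (k + 2) → V) :
    wick hB (ιMulti ℝ (k + 2) v) = ∑ j : Fin (k + 1), (-1) ^ (j : ℕ) * B (v 0) (v j.succ) *
      wick hB (ιMulti ℝ k (fun r => v (j.succAbove r).succ)) := by
  rw [ιMulti_succ_apply, wick_ι_mul, contract_ιMulti, map_sum]
  simp [Matrix.vecTail]

theorem wick_ιMulti (N : ℕ) (v : Fin (2 * N) → V) :
    wick hB (ιMulti ℝ (2 * N) v) = pfaffian N (fun r s => B (v r) (v s)) := by
  induction N with
  | zero => rw [pfaffian_zero]; simp [wick_one]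
  | succ N ih =>
    rw [pfaffian_succ]
    refine (wick_ιMulti_succ hB (k := 2 * N) v).trans ?_
    exact Finset.sum_congr rfl fun j _ => by rw [ih]

/-- The linear form `v ↦ Pf(v ∧ y)`. -/
noncomputable def rowForm (y : ExteriorAlgebra ℝ V) : Module.Dual ℝ V :=
  wick hB ∘ₗ LinearMap.mulRight ℝ y ∘ₗ ExteriorAlgebra.ι ℝ

lemma rowForm_apply (y : ExteriorAlgebra ℝ V) (v : V) :
    rowForm hB y v = wick hB (ExteriorAlgebra.ι ℝ v * y) := rfl

/-- The quadratic relations of the Pfaffian.  In a basis `e_i` the left side is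
`∑ B(e_i, e_j) Pf(e_i^* ⌋ x) Pf(e_j^* ⌋ y)`, which is antisymmetric in `x` and `y` because `B` is. -/
theorem wick_contract_rowForm [Module.Finite ℝ V] (x y : ExteriorAlgebra ℝ V) :
    wick hB (contract (rowForm hB y) x) = -wick hB (contract (rowForm hB x) y) := by
  let b := Module.finBasis ℝ V
  have key : ∀ x y : ExteriorAlgebra ℝ V, wick hB (contract (rowForm hB y) x) =
      ∑ i, ∑ j, B (b i) (b j) * (wick hB (contract (b.coord j) y) *
        wick hB (contract (b.coord i) x)) := by
    intro x y
    have hd : ∀ d : Module.Dual ℝ V, d = ∑ i, d (b i) • b.coord i := fun d => by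
      refine b.ext fun j => ?_
      simp
    rw [hd (rowForm hB y), contract_sum, map_sum]
    refine Finset.sum_congr rfl fun i _ => ?_
    rw [contract_smul, map_smul, rowForm_apply, wick_ι_mul, hd (B (b i)), contract_sum, map_sum,
      smul_eq_mul, Finset.sum_mul]
    refine Finset.sum_congr rfl fun j _ => ?_
    rw [contract_smul, map_smul, smul_eq_mul, mul_assoc]
    congr 1
    rw [← hd]
  rw [key, key y x, Finset.sum_comm, ← Finset.sum_neg_distrib]
  refine Finset.sum_congr rfl fun i _ => ?_
  rw [← Finset.sum_neg_distrib]
  refine Finset.sum_congr rfl fun j _ => ?_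
  rw [← hB.neg_eq (b i) (b j)]
  ring

/-- The product `v₁ ∧ ⋯ ∧ v_k` of a list of vectors. -/
noncomputable def wedge (L : List V) : ExteriorAlgebra ℝ V := (L.map (ExteriorAlgebra.ι ℝ)).prod

lemma wedge_nil : wedge ([] : List V) = 1 := rfl

lemma wedge_cons (v : V) (L : List V) : wedge (v :: L) = ExteriorAlgebra.ι ℝ v * wedge L := by
  simp [wedge]

lemma wedge_ofFn {k : ℕ} (v : Fin k → V) : wedge (List.ofFn v) = ιMulti ℝ k v := by
  simp [wedge, ιMulti_apply, List.map_ofFn, Function.comp_def]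

lemma ι_mul_swap (v w : V) (x : ExteriorAlgebra ℝ V) :
    ExteriorAlgebra.ι ℝ v * (ExteriorAlgebra.ι ℝ w * x) =
      -(ExteriorAlgebra.ι ℝ w * (ExteriorAlgebra.ι ℝ v * x)) := by
  rw [← mul_assoc, ← mul_assoc, eq_neg_of_add_eq_zero_left (ι_add_mul_swap v w), neg_mul]

lemma wedge_swap (v w : V) (L : List V) : wedge (v :: w :: L) = -wedge (w :: v :: L) := by
  simp only [wedge_cons]
  exact ι_mul_swap v w _

lemma wedge_eq_zero_of_mem {v : V} {L : List V} (h : v ∈ L) : wedge (v :: L) = 0 := by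
  induction L with
  | nil => simp at h
  | cons w L ih =>
    rcases List.mem_cons.1 h with rfl | h
    · rw [wedge_cons, wedge_cons, ← mul_assoc, ι_sq_zero, zero_mul]
    · rw [wedge_swap, wedge_cons, ih h, mul_zero, neg_zero]

lemma wedge_append_singleton (L : List V) (v : V) :
    wedge (L ++ [v]) = (-1 : ℝ) ^ L.length • wedge (v :: L) := by
  induction L with
  | nil => simp
  | cons w L ih =>
    rw [List.cons_append, wedge_cons, ih, mul_smul_comm, ← wedge_cons, wedge_swap,
      List.length_cons, pow_succ]
    simp

lemma contract_wedge_cons (d : Module.Dual ℝ V) (v : V) (L : List V) :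
    contract d (wedge (v :: L)) = d v • wedge L - ExteriorAlgebra.ι ℝ v * contract d (wedge L) := by
  rw [wedge_cons, contract_ι_mul]

lemma contract_wedge_eq_zero (d : Module.Dual ℝ V) {L : List V} (h : ∀ v ∈ L, d v = 0) :
    contract d (wedge L) = 0 := by
  induction L with
  | nil => exact contract_one d
  | cons v L ih =>
    rw [contract_wedge_cons, h v (by simp), ih fun w hw => h w (by simp [hw])]
    simp

lemma rowForm_wedge_eq_zero {v : V} {L : List V} (h : v ∈ L) : rowForm hB (wedge L) v = 0 := by
  rw [rowForm_apply, ← wedge_cons, wedge_eq_zero_of_mem h, map_zero]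

/-- The quadratic relation between Pfaffians with one and three extra rows. -/
theorem wick_plucker_odd [Module.Finite ℝ V] (a b c d : V) (X : List V) :
    wick hB (wedge (a :: X)) * wick hB (wedge (b :: c :: d :: X))
      - wick hB (wedge (b :: X)) * wick hB (wedge (a :: c :: d :: X))
      + wick hB (wedge (c :: X)) * wick hB (wedge (a :: b :: d :: X))
      - wick hB (wedge (d :: X)) * wick hB (wedge (a :: b :: c :: X)) = 0 := by
  have h := wick_contract_rowForm hB (wedge (a :: b :: c :: d :: X)) (wedge X)
  rw [contract_wedge_eq_zero (L := X) _ fun v hv => rowForm_wedge_eq_zero hB (by simp [hv]),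
    map_zero, neg_zero] at h
  simp only [contract_wedge_cons, contract_wedge_eq_zero _ fun v hv => rowForm_wedge_eq_zero hB hv,
    rowForm_apply, mul_zero, sub_zero, mul_sub, map_sub, mul_smul_comm, map_smul, ← wedge_cons,
    smul_eq_mul] at h
  linarith

/-- The quadratic relation between Pfaffians with no, two and four extra rows. -/
theorem wick_plucker_even [Module.Finite ℝ V] (a b c d : V) (X : List V) :
    wick hB (wedge (a :: b :: c :: d :: X)) * wick hB (wedge X)
      - wick hB (wedge (a :: b :: X)) * wick hB (wedge (c :: d :: X))
      + wick hB (wedge (a :: c :: X)) * wick hB (wedge (b :: d :: X))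
      - wick hB (wedge (a :: d :: X)) * wick hB (wedge (b :: c :: X)) = 0 := by
  have h := wick_contract_rowForm hB (wedge (b :: c :: d :: X)) (wedge (a :: X))
  have h1 : contract (rowForm hB (wedge (a :: X))) (wedge X) = 0 :=
    contract_wedge_eq_zero _ fun v hv => rowForm_wedge_eq_zero hB (by simp [hv])
  have h2 : contract (rowForm hB (wedge (b :: c :: d :: X))) (wedge X) = 0 :=
    contract_wedge_eq_zero _ fun v hv => rowForm_wedge_eq_zero hB (by simp [hv])
  have s1 : wedge (b :: a :: X) = -wedge (a :: b :: X) := wedge_swap _ _ _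
  have s2 : wedge (c :: a :: X) = -wedge (a :: c :: X) := wedge_swap _ _ _
  have s3 : wedge (d :: a :: X) = -wedge (a :: d :: X) := wedge_swap _ _ _
  simp only [contract_wedge_cons, h1, h2, rowForm_apply, mul_zero, sub_zero, mul_sub, map_sub,
    mul_smul_comm, map_smul, ← wedge_cons, smul_eq_mul, s1, s2, s3, map_neg] at h
  linarith

end Wick

end GenNovikov

/-! ### The Schur Pfaffian -/

namespace GenNovikov

open ExteriorAlgebra

section Schur

variable {n : ℕ} (μ : Fin n → ℝ)

/-- The Schur kernel `(μ_p - μ_q) / (μ_p + μ_q)`. -/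
noncomputable def kernel (p q : Fin n) : ℝ := (μ p - μ q) / (μ p + μ q)

lemma kernel_antisymm (p q : Fin n) : kernel μ p q = -kernel μ q p := by
  unfold kernel
  rw [← neg_div, neg_sub, add_comm]

lemma kernel_self (p : Fin n) : kernel μ p p = 0 := by
  simp [kernel]

lemma add_mul_kernel (hμ : ∀ p, 0 < μ p) (p q : Fin n) :
    (μ p + μ q) * kernel μ p q = μ p - μ q :=
  mul_div_cancel₀ _ (add_pos (hμ p) (hμ q)).ne'

lemma kernel_ne_zero (hμ : ∀ p, 0 < μ p) (hinj : Function.Injective μ) {p q : Fin n}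
    (h : p ≠ q) : kernel μ p q ≠ 0 :=
  div_ne_zero (sub_ne_zero.2 (hinj.ne h)) (add_pos (hμ p) (hμ q)).ne'

/-- The Schur kernel bordered by two further rows: the row of ones (index `inr false`) and the
row `μ` (index `inr true`); these are the first two coefficients of `(x - μ_q) / (x + μ_q)` at
`x = ∞`, up to normalisation. -/
noncomputable def borderedKernel : Matrix (Fin n ⊕ Bool) (Fin n ⊕ Bool) ℝ
  | .inl p, .inl q => kernel μ p q
  | .inl _, .inr false => -1
  | .inl p, .inr true => -μ p
  | .inr false, .inl _ => 1
  | .inr true, .inl q => μ q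
  | .inr _, .inr _ => 0

/-- The space spanned by one vector for each `p : Fin n` and two bordering vectors. -/
abbrev SchurSpace (n : ℕ) : Type := Fin n ⊕ Bool → ℝ

/-- The coordinate forms of `SchurSpace n`. -/
noncomputable def crd (x : Fin n ⊕ Bool) : Module.Dual ℝ (SchurSpace n) := LinearMap.proj x

@[simp] lemma crd_apply (x : Fin n ⊕ Bool) (v : SchurSpace n) : crd x v = v x := rfl

/-- The basis vector of index `p`. -/
noncomputable def pt (p : Fin n) : SchurSpace n := Pi.single (.inl p) 1

/-- The bordering vector that pairs to `1` with each `pt p`. -/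
noncomputable def d₀ : SchurSpace n := Pi.single (.inr false) 1

/-- The bordering vector that pairs to `μ p` with `pt p`. -/
noncomputable def d₁ : SchurSpace n := Pi.single (.inr true) 1

/-- The alternating form with matrix `borderedKernel`. -/
noncomputable def schurForm : LinearMap.BilinForm ℝ (SchurSpace n) :=
  Matrix.toBilin' (borderedKernel μ)

lemma borderedKernel_antisymm (x y : Fin n ⊕ Bool) :
    borderedKernel μ x y = -borderedKernel μ y x := by
  rcases x with p | (_ | _) <;> rcases y with q | (_ | _) <;> simp [borderedKernel]
  exact kernel_antisymm μ p q

lemma schurForm_single (x : Fin n ⊕ Bool) :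
    schurForm μ (Pi.single x 1) = ∑ y, borderedKernel μ x y • crd y := by
  refine LinearMap.pi_ext' fun y => LinearMap.ext_ring ?_
  rw [LinearMap.comp_apply, LinearMap.comp_apply, LinearMap.sum_apply, LinearMap.coe_single,
    schurForm, Matrix.toBilin'_single, Finset.sum_eq_single y]
  · simp
  · intro z _ hz
    simp [hz]
  · simp

lemma schurForm_apply (v w : SchurSpace n) :
    schurForm μ v w = ∑ x, ∑ y, v x * borderedKernel μ x y * w y := by
  simp [schurForm, Matrix.toBilin'_apply]

lemma schurForm_isAlt : (schurForm μ).IsAlt := by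
  intro v
  have h : schurForm μ v v = -schurForm μ v v := by
    conv_rhs => rw [schurForm_apply, Finset.sum_comm]
    rw [schurForm_apply, ← Finset.sum_neg_distrib]
    refine Finset.sum_congr rfl fun x _ => ?_
    rw [← Finset.sum_neg_distrib]
    refine Finset.sum_congr rfl fun y _ => ?_
    rw [borderedKernel_antisymm μ x y]
    ring
  linarith

/-- The Pfaffian functional of the bordered Schur kernel. -/
noncomputable abbrev schurPf : ExteriorAlgebra ℝ (SchurSpace n) →ₗ[ℝ] ℝ := wick (schurForm_isAlt μ)

lemma schurForm_pt (p : Fin n) :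
    schurForm μ (pt p) = ∑ q, kernel μ p q • crd (.inl q)
      - crd (.inr false) - μ p • crd (.inr true) := by
  rw [pt, schurForm_single, Fintype.sum_sum_type]
  refine LinearMap.ext fun v => ?_
  simp only [borderedKernel, Fintype.sum_bool, LinearMap.add_apply, LinearMap.sub_apply,
    LinearMap.smul_apply, crd_apply, smul_eq_mul]
  ring

lemma schurForm_d₀ : schurForm μ d₀ = ∑ q, crd (.inl q) := by
  rw [d₀, schurForm_single, Fintype.sum_sum_type]
  simp [borderedKernel]

lemma schurForm_d₁ : schurForm μ d₁ = ∑ q, μ q • crd (.inl q) := by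
  rw [d₁, schurForm_single, Fintype.sum_sum_type]
  simp [borderedKernel]

/-- The derivation of the exterior algebra that multiplies `pt p` by `μ p` and annihilates the
bordering vectors. -/
noncomputable def weight (x : ExteriorAlgebra ℝ (SchurSpace n)) : ExteriorAlgebra ℝ (SchurSpace n) :=
  ∑ p, μ p • (ExteriorAlgebra.ι ℝ (pt p) * contract (crd (.inl p)) x)

lemma weight_pt_mul (p : Fin n) (x : ExteriorAlgebra ℝ (SchurSpace n)) :
    weight μ (ExteriorAlgebra.ι ℝ (pt p) * x) =
      μ p • (ExteriorAlgebra.ι ℝ (pt p) * x) + ExteriorAlgebra.ι ℝ (pt p) * weight μ x := by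
  have h : ∀ q : Fin n, μ q • (ExteriorAlgebra.ι ℝ (pt q) *
      contract (crd (.inl q)) (ExteriorAlgebra.ι ℝ (pt p) * x)) =
      (if q = p then μ p • (ExteriorAlgebra.ι ℝ (pt p) * x) else 0) + ExteriorAlgebra.ι ℝ (pt p) *
        (μ q • (ExteriorAlgebra.ι ℝ (pt q) * contract (crd (.inl q)) x)) := by
    intro q
    rw [contract_ι_mul, mul_sub, ι_mul_swap (pt q) (pt p), sub_neg_eq_add, smul_add,
      mul_smul_comm (μ q)]
    congr 1
    split_ifs with h
    · subst h
      simp [pt]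
    · simp [pt, h]
  unfold weight
  simp_rw [h]
  rw [Finset.sum_add_distrib, Finset.mul_sum]
  simp

lemma weight_d₀_mul (x : ExteriorAlgebra ℝ (SchurSpace n)) :
    weight μ (ExteriorAlgebra.ι ℝ d₀ * x) = ExteriorAlgebra.ι ℝ d₀ * weight μ x := by
  unfold weight
  rw [Finset.mul_sum]
  refine Finset.sum_congr rfl fun q _ => ?_
  rw [contract_ι_mul, mul_sub, ι_mul_swap (pt q) d₀, sub_neg_eq_add, smul_add, mul_smul_comm (μ q)]
  simp [d₀]

lemma weight_wedge_pt (L : List (Fin n)) :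
    weight μ (wedge (L.map pt)) = (L.map μ).sum • wedge (L.map pt) := by
  induction L with
  | nil => simp [weight, wedge_nil, contract_one]
  | cons p L ih =>
    rw [List.map_cons, wedge_cons, weight_pt_mul, ih, List.map_cons, List.sum_cons, add_smul,
      mul_smul_comm]

/-- Since `(μ_p + μ_q) K(p,q) = μ_p - μ_q`, the part of the form `B` on the vectors `pt p`
turns the weight derivation into a product of two contractions. -/
lemma schurPf_weight (hμ : ∀ p, 0 < μ p) (x : ExteriorAlgebra ℝ (SchurSpace n))
    (hx : contract (crd (.inr true)) x = 0) :
    schurPf μ (weight μ x) =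
      schurPf μ (contract (schurForm μ d₀) (contract (schurForm μ d₁) x))
        - schurPf μ (contract (crd (.inr false)) (contract (schurForm μ d₁) x)) := by
  set c : Fin n → Fin n → ℝ := fun p q => schurPf μ
    (contract (crd (.inl q)) (contract (crd (.inl p)) x)) with hc
  have hanti : ∀ p q, c p q = -c q p := fun p q => by
    simp only [hc]
    rw [contract_comm, map_neg]
  have h1 : schurPf μ (weight μ x) = ∑ p, ∑ q, μ p * kernel μ p q * c p q
      - ∑ p, μ p * schurPf μ (contract (crd (.inr false))
          (contract (crd (.inl p)) x)) := by
    unfold weight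
    rw [map_sum, ← Finset.sum_sub_distrib]
    refine Finset.sum_congr rfl fun p _ => ?_
    have h0 : contract (schurForm μ (pt p)) (contract (crd (.inl p)) x) =
        ∑ q, kernel μ p q • contract (crd (.inl q))
            (contract (crd (.inl p)) x)
          - contract (crd (.inr false)) (contract (crd (.inl p)) x) := by
      rw [schurForm_pt, sub_eq_add_neg, sub_eq_add_neg]
      have hadd : ∀ (d d' : Module.Dual ℝ (SchurSpace n)) y,
          contract (d + -d') y = contract d y - contract d' y := fun d d' y => by
        unfold contract
        rw [map_add, map_neg, LinearMap.add_apply, LinearMap.neg_apply, sub_eq_add_neg]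
      rw [hadd, hadd, contract_sum, contract_smul]
      rw [contract_comm (crd (.inr true)), hx]
      simp [contract_smul]
    rw [map_smul, wick_ι_mul, h0, map_sub, map_sum, smul_eq_mul, mul_sub, Finset.mul_sum]
    congr 1
    refine Finset.sum_congr rfl fun q _ => ?_
    rw [map_smul, smul_eq_mul, mul_assoc]
  have h2 : schurPf μ (contract (schurForm μ d₀) (contract (schurForm μ d₁) x)) =
      ∑ p, ∑ q, μ p * c p q := by
    rw [schurForm_d₀, schurForm_d₁, contract_sum, contract_sum, map_sum, Finset.sum_comm]
    refine Finset.sum_congr rfl fun q _ => ?_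
    rw [map_sum, map_sum]
    refine Finset.sum_congr rfl fun p _ => ?_
    rw [contract_smul, map_smul, map_smul, smul_eq_mul]
  have h3 : schurPf μ (contract (crd (.inr false)) (contract (schurForm μ d₁) x)) =
      ∑ p, μ p * schurPf μ (contract (crd (.inr false))
          (contract (crd (.inl p)) x)) := by
    rw [schurForm_d₁, contract_sum, map_sum, map_sum]
    refine Finset.sum_congr rfl fun p _ => ?_
    rw [contract_smul, map_smul, map_smul, smul_eq_mul]
  have h4 : ∑ p, ∑ q, μ p * kernel μ p q * c p q = ∑ p, ∑ q, μ p * c p q := by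
    have e1 : ∑ p, ∑ q, μ p * kernel μ p q * c p q = ∑ p, ∑ q, μ q * kernel μ p q * c p q := by
      rw [Finset.sum_comm]
      refine Finset.sum_congr rfl fun q _ => Finset.sum_congr rfl fun p _ => ?_
      rw [hanti, kernel_antisymm]
      ring
    have e2 : ∑ p, ∑ q, μ p * c p q = -∑ p, ∑ q, μ q * c p q := by
      rw [Finset.sum_comm, ← Finset.sum_neg_distrib]
      refine Finset.sum_congr rfl fun q _ => ?_
      rw [← Finset.sum_neg_distrib]
      refine Finset.sum_congr rfl fun p _ => ?_
      rw [hanti]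
      ring
    have e3 : ∑ p, ∑ q, μ p * kernel μ p q * c p q + ∑ p, ∑ q, μ q * kernel μ p q * c p q =
        ∑ p, ∑ q, μ p * c p q - ∑ p, ∑ q, μ q * c p q := by
      simp_rw [← Finset.sum_add_distrib, ← Finset.sum_sub_distrib]
      refine Finset.sum_congr rfl fun p _ => Finset.sum_congr rfl fun q _ => ?_
      linear_combination c p q * add_mul_kernel μ hμ p q
    linarith
  rw [h1, h2, h3, h4]

lemma contract_border_wedge_pt (b : Bool) (L : List (Fin n)) :
    contract (crd (.inr b)) (wedge (L.map pt)) = 0 := by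
  refine contract_wedge_eq_zero _ fun v hv => ?_
  obtain ⟨p, _, rfl⟩ := List.mem_map.1 hv
  simp [pt]

lemma schurForm_d₀_d₀ : schurForm μ d₀ d₀ = 0 := schurForm_isAlt μ d₀

lemma schurForm_d₁_d₀ : schurForm μ d₁ d₀ = 0 := by
  rw [schurForm_d₁]
  simp [d₀]

lemma schurForm_d₀_d₁ : schurForm μ d₀ d₁ = 0 := by
  rw [schurForm_d₀]
  simp [d₁]

lemma schurPf_d₀_d₁_wedge (hμ : ∀ p, 0 < μ p) (L : List (Fin n)) :
    schurPf μ (wedge (d₀ :: d₁ :: L.map pt)) = (L.map μ).sum * schurPf μ (wedge (L.map pt)) := by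
  have h := schurPf_weight μ hμ _ (contract_border_wedge_pt true L)
  rw [weight_wedge_pt, map_smul, contract_comm (crd (.inr false)),
    contract_border_wedge_pt, map_zero, neg_zero, map_zero, sub_zero, smul_eq_mul] at h
  rw [h, wedge_cons, wick_ι_mul, contract_wedge_cons, schurForm_d₀_d₁, zero_smul, zero_sub, map_neg,
    wick_ι_mul, contract_comm (schurForm μ d₁), map_neg, neg_neg]

lemma schurPf_d₁_wedge (hμ : ∀ p, 0 < μ p) (L : List (Fin n)) :
    schurPf μ (wedge (d₁ :: L.map pt)) = (L.map μ).sum * schurPf μ (wedge (d₀ :: L.map pt)) := by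
  have h := schurPf_weight μ hμ (wedge (d₀ :: L.map pt)) (by
    rw [contract_wedge_cons, contract_border_wedge_pt]
    simp [d₀])
  rw [wedge_cons, weight_d₀_mul, weight_wedge_pt, mul_smul_comm, map_smul, smul_eq_mul,
    contract_ι_mul, schurForm_d₁_d₀, zero_smul, zero_sub, map_neg, map_neg, contract_ι_mul,
    schurForm_d₀_d₀, zero_smul, zero_sub, map_neg, neg_neg, map_neg, contract_ι_mul, map_neg, map_sub,
    wick_ι_mul (schurForm_isAlt μ) d₀ (contract _ (contract _ _)),
    contract_comm _ _ (contract _ (wedge _)), contract_comm (crd (.inr false)),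
    contract_border_wedge_pt] at h
  have hz : ∀ y, contract (schurForm μ d₀) (contract (schurForm μ d₀) y) = 0 := fun y =>
    CliffordAlgebra.contractLeft_contractLeft _ y
  rw [hz] at h
  rw [wedge_cons, wedge_cons, wick_ι_mul, h]
  simp [d₀]

/-- The product `∏_{r < s} K(p_r, p_s)` over the pairs of positions of a list. -/
noncomputable def kernelProd : List (Fin n) → ℝ
  | [] => 1
  | p :: L => (L.map (kernel μ p)).prod * kernelProd L

lemma kernelProd_eq_zero {L : List (Fin n)} (h : ¬L.Nodup) : kernelProd μ L = 0 := by
  induction L with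
  | nil => simp at h
  | cons p L ih =>
    rw [kernelProd]
    by_cases hp : p ∈ L
    · rw [List.prod_eq_zero, zero_mul]
      exact List.mem_map.2 ⟨p, hp, kernel_self μ p⟩
    · rw [ih fun hL => h (List.nodup_cons.2 ⟨hp, hL⟩), mul_zero]

lemma kernelProd_ne_zero (hμ : ∀ p, 0 < μ p) (hinj : Function.Injective μ) {L : List (Fin n)}
    (h : L.Nodup) : kernelProd μ L ≠ 0 := by
  induction L with
  | nil => simp [kernelProd]
  | cons p L ih =>
    rw [List.nodup_cons] at h
    refine mul_ne_zero (List.prod_ne_zero fun h0 => ?_) (ih h.2)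
    obtain ⟨q, hq, h0⟩ := List.mem_map.1 h0
    exact kernel_ne_zero μ hμ hinj (fun e => h.1 (by rwa [e])) h0

/-- The Pfaffian functional in degree `k`, with the row `d₀` adjoined when `k` is odd. -/
noncomputable def tau (k : ℕ) : ExteriorAlgebra ℝ (SchurSpace n) →ₗ[ℝ] ℝ :=
  if Even k then schurPf μ else schurPf μ ∘ₗ LinearMap.mulLeft ℝ (ExteriorAlgebra.ι ℝ d₀)

/-- The companion of `tau` with the row `d₁` adjoined. -/
noncomputable def tauDot (k : ℕ) : ExteriorAlgebra ℝ (SchurSpace n) →ₗ[ℝ] ℝ :=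
  if Even k then
    schurPf μ ∘ₗ LinearMap.mulLeft ℝ (ExteriorAlgebra.ι ℝ d₀ * ExteriorAlgebra.ι ℝ d₁)
  else schurPf μ ∘ₗ LinearMap.mulLeft ℝ (ExteriorAlgebra.ι ℝ d₁)

variable {μ} in
lemma tau_even {k : ℕ} (h : Even k) (L : List (SchurSpace n)) :
    tau μ k (wedge L) = schurPf μ (wedge L) := by
  simp [tau, h]

variable {μ} in
lemma tau_odd {k : ℕ} (h : ¬Even k) (L : List (SchurSpace n)) :
    tau μ k (wedge L) = schurPf μ (wedge (d₀ :: L)) := by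
  simp [tau, h, wedge_cons]

variable {μ} in
lemma tauDot_even {k : ℕ} (h : Even k) (L : List (SchurSpace n)) :
    tauDot μ k (wedge L) = schurPf μ (wedge (d₀ :: d₁ :: L)) := by
  simp [tauDot, h, wedge_cons]

variable {μ} in
lemma tauDot_odd {k : ℕ} (h : ¬Even k) (L : List (SchurSpace n)) :
    tauDot μ k (wedge L) = schurPf μ (wedge (d₁ :: L)) := by
  simp [tauDot, h, wedge_cons]

lemma tauDot_wedge_pt (hμ : ∀ p, 0 < μ p) (k : ℕ) (L : List (Fin n)) :
    tauDot μ k (wedge (L.map pt)) = (L.map μ).sum * tau μ k (wedge (L.map pt)) := by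
  by_cases h : Even k
  · rw [tauDot_even h, tau_even h, schurPf_d₀_d₁_wedge μ hμ]
  · rw [tauDot_odd h, tau_odd h, schurPf_d₁_wedge μ hμ]

/-- The first bilinear relation: adjoining a vector on the left and one on the right. -/
theorem tau_bilinear_dot (k : ℕ) (X : List (SchurSpace n)) (p q : SchurSpace n) :
    tauDot μ k (wedge (p :: q :: X)) * tau μ k (wedge X)
        - tau μ k (wedge (p :: q :: X)) * tauDot μ k (wedge X) =
      tauDot μ (k + 1) (wedge (p :: X)) * tau μ (k + 1) (wedge (q :: X))
        - tau μ (k + 1) (wedge (p :: X)) * tauDot μ (k + 1) (wedge (q :: X)) := by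
  by_cases h : Even k
  · have h' : ¬Even (k + 1) := by simpa [Nat.even_add_one] using h
    simp only [tau_even h, tau_odd h', tauDot_even h, tauDot_odd h']
    linarith [wick_plucker_even (schurForm_isAlt μ) d₀ d₁ p q X]
  · have h' : Even (k + 1) := by simpa [Nat.even_add_one] using h
    simp only [tau_even h', tau_odd h, tauDot_even h', tauDot_odd h]
    linarith [wick_plucker_odd (schurForm_isAlt μ) d₀ d₁ p q X]

/-- The second bilinear relation: three vectors adjoined. -/
theorem tau_bilinear_three (k : ℕ) (X : List (SchurSpace n)) (p p' q : SchurSpace n) :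
    tau μ (k + 1) (wedge (q :: X)) * tau μ k (wedge (p :: p' :: X))
        - tau μ (k + 1) (wedge (p :: p' :: q :: X)) * tau μ k (wedge X) =
      tau μ k (wedge (p :: q :: X)) * tau μ (k + 1) (wedge (p' :: X))
        - tau μ k (wedge (p' :: q :: X)) * tau μ (k + 1) (wedge (p :: X)) := by
  by_cases h : Even k
  · have h' : ¬Even (k + 1) := by simpa [Nat.even_add_one] using h
    simp only [tau_even h, tau_odd h']
    linarith [wick_plucker_even (schurForm_isAlt μ) d₀ p p' q X]
  · have h' : Even (k + 1) := by simpa [Nat.even_add_one] using h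
    simp only [tau_even h', tau_odd h]
    linarith [wick_plucker_odd (schurForm_isAlt μ) d₀ p p' q X]

lemma tau_add_two (k : ℕ) : tau μ (k + 2) = tau μ k := by
  simp [tau, Nat.even_add]

lemma tauDot_add_two (k : ℕ) : tauDot μ (k + 2) = tauDot μ k := by
  simp [tauDot, Nat.even_add]

/-- The Schur Pfaffian.  The bilinear relation `tau_bilinear_dot` evaluated at basis vectors is the
recursion `τ(p,q,X) τ(X) = K(p,q) τ(p,X) τ(q,X)`. -/
theorem tau_wedge_pt (hμ : ∀ p, 0 < μ p) (hinj : Function.Injective μ) (L : List (Fin n)) :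
    tau μ L.length (wedge (L.map pt)) = kernelProd μ L := by
  induction h : L.length using Nat.strong_induction_on generalizing L with
  | _ k ih =>
    subst h
    match L with
    | [] => simp [tau, wedge_nil, wick_one, kernelProd]
    | [p] =>
      have h1 : ¬Even [p].length := by simp
      rw [tau_odd h1, wedge_cons, wick_ι_mul, List.map_cons, List.map_nil, contract_wedge_cons,
        wedge_nil, contract_one, mul_zero, sub_zero, map_smul, wick_one, schurForm_d₀]
      simp [pt, kernelProd, Pi.single_apply]
    | p :: q :: X =>
      by_cases hd : (p :: q :: X).Nodup
      · have hX : kernelProd μ X ≠ 0 := kernelProd_ne_zero μ hμ hinj hd.of_cons.of_cons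
        have i0 := ih X.length (by simp) X rfl
        have ip := ih (X.length + 1) (by simp) (p :: X) (by simp)
        have iq := ih (X.length + 1) (by simp) (q :: X) (by simp)
        have b := tau_bilinear_dot μ X.length (X.map pt) (pt p) (pt q)
        simp only [← List.map_cons, tauDot_wedge_pt μ hμ] at b
        simp only [List.length_cons] at ip iq ⊢
        rw [tau_add_two]
        rw [i0, ip, iq] at b
        refine mul_right_cancel₀ hX ?_
        have hs : μ p + μ q ≠ 0 := (add_pos (hμ p) (hμ q)).ne'
        refine mul_left_cancel₀ hs ?_
        have ha := add_mul_kernel μ hμ p q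
        simp only [List.map_cons, List.sum_cons, List.prod_cons, kernelProd] at b ⊢
        linear_combination b - ha * (X.map (kernel μ p)).prod * (X.map (kernel μ q)).prod *
          kernelProd μ X * kernelProd μ X
      · rw [kernelProd_eq_zero μ hd]
        have hz : ∀ L : List (Fin n), ¬L.Nodup → wedge (L.map (pt (n := n))) = 0 := by
          intro L
          induction L with
          | nil => intro h; simp at h
          | cons p L ih =>
            intro h
            by_cases hp : p ∈ L
            · exact wedge_eq_zero_of_mem (List.mem_map_of_mem hp)
            · rw [List.map_cons, wedge_cons, ih fun hL => h (List.nodup_cons.2 ⟨hp, hL⟩), mul_zero]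
        rw [hz _ hd, map_zero]

end Schur

end GenNovikov

/-! ### The double integrals -/

namespace GenNovikov

open MeasureTheory Set

lemma integrableOn_and_integral_exp_Iio {l : ℝ} (hl : 0 < l) (y : ℝ) :
    IntegrableOn (fun x => Real.exp (l * x)) (Iio y) ∧
      ∫ x in Iio y, Real.exp (l * x) = Real.exp (l * y) / l := by
  refine ⟨(integrableOn_exp_mul_Iic hl y).mono_set Iio_subset_Iic_self, ?_⟩
  rw [← integral_Iic_eq_integral_Iio, integral_exp_mul_Iic hl]

/-- The double integral of an exponential over the region `t₁ < t₂ < t`. -/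
lemma integrableOn_and_integral_exp_exp {g l : ℝ} (hg : 0 < g) (hl : 0 < l) (t : ℝ) :
    IntegrableOn (fun p : ℝ × ℝ => Real.exp (g * p.2) * Real.exp (l * p.1))
        {p : ℝ × ℝ | p.1 < p.2 ∧ p.2 < t} ∧
      ∫ p in {p : ℝ × ℝ | p.1 < p.2 ∧ p.2 < t}, Real.exp (g * p.2) * Real.exp (l * p.1) =
        Real.exp ((g + l) * t) / (l * (g + l)) := by
  have hS : MeasurableSet {p : ℝ × ℝ | p.1 < p.2 ∧ p.2 < t} :=
    (measurableSet_lt measurable_fst measurable_snd).inter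
      (measurableSet_lt measurable_snd measurable_const)
  set f : ℝ × ℝ → ℝ := {p : ℝ × ℝ | p.1 < p.2 ∧ p.2 < t}.indicator
    (fun p => Real.exp (g * p.2) * Real.exp (l * p.1)) with hf
  have hfs : ∀ y, (fun x => f (x, y)) = if y < t then
      (Iio y).indicator (fun x => Real.exp (g * y) * Real.exp (l * x)) else 0 := by
    intro y
    funext x
    by_cases hy : y < t <;> by_cases hx : x < y <;> simp [hf, hy, hx]
  have hfi : ∀ y, Integrable (fun x => f (x, y)) := by
    intro y
    rw [hfs]
    split_ifs
    · rw [integrable_indicator_iff measurableSet_Iio]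
      exact (integrableOn_and_integral_exp_Iio hl y).1.const_mul _
    · exact integrable_zero _ _ _
  have hint : ∀ y, ∫ x, f (x, y) =
      (Iio t).indicator (fun y => Real.exp ((g + l) * y) * (1 / l)) y := by
    intro y
    rw [hfs]
    by_cases hy : y < t
    · rw [if_pos hy, integral_indicator measurableSet_Iio, integral_const_mul,
        (integrableOn_and_integral_exp_Iio hl y).2, indicator_of_mem (mem_Iio.2 hy), add_mul,
        Real.exp_add]
      ring
    · simp [hy]
  have hnorm : ∀ p, ‖f p‖ = f p := fun p => by
    rw [Real.norm_of_nonneg]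
    exact indicator_nonneg (fun _ _ => by positivity) _
  have hgl : 0 < g + l := add_pos hg hl
  have hI : Integrable f (volume.prod volume) := by
    rw [integrable_prod_iff']
    · refine ⟨Filter.Eventually.of_forall hfi, ?_⟩
      simp_rw [hnorm, hint]
      rw [integrable_indicator_iff measurableSet_Iio]
      exact (integrableOn_and_integral_exp_Iio hgl t).1.mul_const _
    · refine (Measurable.indicator ?_ hS).aestronglyMeasurable
      fun_prop
  refine ⟨(integrable_indicator_iff hS).1 hI, ?_⟩
  rw [← integral_indicator hS]
  refine (integral_prod_symm f hI).trans ?_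
  simp_rw [hint]
  rw [integral_indicator measurableSet_Iio, integral_mul_const,
    (integrableOn_and_integral_exp_Iio hgl t).2]
  field_simp

section Entry

variable {n : ℕ} {α : ℝ} {ζ b₀ : Fin n → ℝ}

/-- The shifted inverse spectral data `μ_p = 1 / ζ_p + α / 2`. -/
noncomputable def shifted (α : ℝ) (ζ : Fin n → ℝ) (p : Fin n) : ℝ := (ζ p)⁻¹ + α / 2

/-- The entries with two integer labels, in closed form. -/
theorem entry_num_num (hα : 0 ≤ α) (hζ : ∀ p, 0 < ζ p) (t : ℝ) (i j : ℤ) :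
    entry α ζ b₀ t (.num i) (.num j) = ∑ p, ∑ q, (ζ p ^ i * bFun ζ b₀ p t) *
      kernel (shifted α ζ) p q * (ζ q ^ j * bFun ζ b₀ q t) := by
  have hl : ∀ p, 0 < (ζ p)⁻¹ := fun p => inv_pos.2 (hζ p)
  have hexp : ∀ p q : Fin n, ∀ z : ℝ × ℝ,
      Real.exp (α * z.2) * (bFun ζ b₀ p z.2 * bFun ζ b₀ q z.1) =
        b₀ p * b₀ q * (Real.exp ((α + (ζ p)⁻¹) * z.2) * Real.exp ((ζ q)⁻¹ * z.1)) := by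
    intro p q z
    unfold bFun
    rw [add_mul, Real.exp_add, div_eq_inv_mul, div_eq_inv_mul]
    ring
  have hbase := fun p q : Fin n => integrableOn_and_integral_exp_exp
    (add_pos_of_nonneg_of_pos hα (hl p)) (hl q) t
  have hprod : ∀ z : ℝ × ℝ, Real.exp (α * z.2) *
      (fFun ζ b₀ (i - 1) z.2 * fFun ζ b₀ (j - 1) z.1
        - fFun ζ b₀ (i - 1) z.1 * fFun ζ b₀ (j - 1) z.2) =
      ∑ p, ∑ q, (ζ p ^ (i - 1) * ζ q ^ (j - 1) - ζ q ^ (i - 1) * ζ p ^ (j - 1)) * (b₀ p * b₀ q) *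
        (Real.exp ((α + (ζ p)⁻¹) * z.2) * Real.exp ((ζ q)⁻¹ * z.1)) := by
    intro z
    unfold fFun
    rw [Finset.sum_mul_sum, Finset.sum_mul_sum,
      Finset.sum_comm (f := fun p q => ζ p ^ (i - 1) * bFun ζ b₀ p z.1 *
        (ζ q ^ (j - 1) * bFun ζ b₀ q z.2)), ← Finset.sum_sub_distrib, Finset.mul_sum]
    refine Finset.sum_congr rfl fun p _ => ?_
    rw [← Finset.sum_sub_distrib, Finset.mul_sum]
    refine Finset.sum_congr rfl fun q _ => ?_
    rw [mul_assoc _ (b₀ p * b₀ q), ← hexp]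
    ring
  rw [entry]
  simp_rw [hprod]
  rw [integral_finsetSum _ fun p _ => integrable_finsetSum _ fun q _ => (hbase p q).1.const_mul _,
    Finset.mul_sum]
  have hval : ∀ p q, Real.exp (-(α * t)) * ((ζ p ^ (i - 1) * ζ q ^ (j - 1)
      - ζ q ^ (i - 1) * ζ p ^ (j - 1)) * (b₀ p * b₀ q) *
        (Real.exp ((α + (ζ p)⁻¹ + (ζ q)⁻¹) * t) / ((ζ q)⁻¹ * (α + (ζ p)⁻¹ + (ζ q)⁻¹)))) =
      (ζ p ^ i * ζ q ^ j - ζ q ^ i * ζ p ^ j) * (bFun ζ b₀ p t * bFun ζ b₀ q t) *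
        ((ζ p)⁻¹ / (α + (ζ p)⁻¹ + (ζ q)⁻¹)) := by
    intro p q
    have hp := (hζ p).ne'
    have hq := (hζ q).ne'
    have hpq : α + (ζ p)⁻¹ + (ζ q)⁻¹ ≠ 0 := by have := hl p; have := hl q; positivity
    unfold bFun
    rw [zpow_sub_one₀ hp, zpow_sub_one₀ hq, zpow_sub_one₀ hp, zpow_sub_one₀ hq, add_mul, add_mul,
      Real.exp_add, Real.exp_add, Real.exp_neg, div_eq_inv_mul t, div_eq_inv_mul t]
    have he := (Real.exp_pos (α * t)).ne'
    generalize α + (ζ p)⁻¹ + (ζ q)⁻¹ = s at hpq ⊢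
    field_simp
  have hone : ∀ p, ∫ z in {z : ℝ × ℝ | z.1 < z.2 ∧ z.2 < t}, ∑ q, (ζ p ^ (i - 1) * ζ q ^ (j - 1)
        - ζ q ^ (i - 1) * ζ p ^ (j - 1)) * (b₀ p * b₀ q) *
        (Real.exp ((α + (ζ p)⁻¹) * z.2) * Real.exp ((ζ q)⁻¹ * z.1)) =
      ∑ q, (ζ p ^ (i - 1) * ζ q ^ (j - 1) - ζ q ^ (i - 1) * ζ p ^ (j - 1)) * (b₀ p * b₀ q) *
        (Real.exp ((α + (ζ p)⁻¹ + (ζ q)⁻¹) * t) / ((ζ q)⁻¹ * (α + (ζ p)⁻¹ + (ζ q)⁻¹))) := by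
    intro p
    rw [integral_finsetSum _ fun q _ => (hbase p q).1.const_mul _]
    refine Finset.sum_congr rfl fun q _ => ?_
    rw [integral_const_mul, (hbase p q).2]
  simp_rw [hone, Finset.mul_sum, hval, sub_mul, Finset.sum_sub_distrib]
  rw [Finset.sum_comm (f := fun p q => ζ q ^ i * ζ p ^ j * (bFun ζ b₀ p t * bFun ζ b₀ q t) *
    ((ζ p)⁻¹ / (α + (ζ p)⁻¹ + (ζ q)⁻¹))), ← Finset.sum_sub_distrib]
  refine Finset.sum_congr rfl fun p _ => ?_
  rw [← Finset.sum_sub_distrib]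
  refine Finset.sum_congr rfl fun q _ => ?_
  have h1 : kernel (shifted α ζ) p q =
      (ζ p)⁻¹ / (α + (ζ p)⁻¹ + (ζ q)⁻¹) - (ζ q)⁻¹ / (α + (ζ q)⁻¹ + (ζ p)⁻¹) := by
    unfold kernel shifted
    rw [show α + (ζ q)⁻¹ + (ζ p)⁻¹ = α + (ζ p)⁻¹ + (ζ q)⁻¹ by ring, ← sub_div]
    congr 1 <;> ring
  rw [h1]
  ring

/-- The vector of `SchurSpace n` with coordinates `g`. -/
noncomputable def vec (g : Fin n → ℝ) : SchurSpace n := ∑ p, g p • pt p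

lemma schurForm_pt_pt (μ : Fin n → ℝ) (p q : Fin n) :
    schurForm μ (pt p) (pt q) = kernel μ p q := by
  simp [schurForm, pt, Matrix.toBilin'_single, borderedKernel]

lemma schurForm_vec_vec (μ g h : Fin n → ℝ) :
    schurForm μ (vec g) (vec h) = ∑ p, ∑ q, g p * kernel μ p q * h q := by
  simp only [vec, map_sum, map_smul, LinearMap.sum_apply, LinearMap.smul_apply, schurForm_pt_pt,
    smul_eq_mul]
  rw [Finset.sum_comm]
  refine Finset.sum_congr rfl fun p _ => ?_
  rw [Finset.mul_sum]
  refine Finset.sum_congr rfl fun q _ => ?_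
  ring

lemma schurForm_d₀_vec (μ g : Fin n → ℝ) : schurForm μ d₀ (vec g) = ∑ p, g p := by
  rw [schurForm_d₀]
  simp [vec, pt, Finset.sum_apply, Pi.single_apply]

/-- The vector of `SchurSpace n` that realises a label at time `t`. -/
noncomputable def labelVec (ζ b₀ : Fin n → ℝ) (t : ℝ) : Label → SchurSpace n
  | .d0 => d₀
  | .num i => vec fun p => ζ p ^ i * bFun ζ b₀ p t

theorem entry_eq_schurForm (hα : 0 ≤ α) (hζ : ∀ p, 0 < ζ p) (t : ℝ) (r s : Label) :
    entry α ζ b₀ t r s = schurForm (shifted α ζ) (labelVec ζ b₀ t r) (labelVec ζ b₀ t s) := by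
  rcases r with _ | i <;> rcases s with _ | j
  · simp [entry, labelVec, schurForm_d₀_d₀]
  · simp [entry, labelVec, schurForm_d₀_vec, fFun]
  · rw [← (schurForm_isAlt _).neg_eq]
    simp [entry, labelVec, schurForm_d₀_vec, fFun]
  · rw [entry_num_num hα hζ]
    simp only [labelVec]
    rw [schurForm_vec_vec]

/-- The vectors realising the labels `l, l + 1, …, l + k - 1`. -/
noncomputable def numVecs (ζ b₀ : Fin n → ℝ) (t : ℝ) (l : ℤ) (k : ℕ) : List (SchurSpace n) :=
  List.ofFn fun r : Fin k => labelVec ζ b₀ t (.num (l + r))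

theorem tildeP_eq_tau (hα : 0 ≤ α) (hζ : ∀ p, 0 < ζ p) (l : ℤ) (k : ℕ) (t : ℝ) :
    tildeP α ζ b₀ l k t = tau (shifted α ζ) k (wedge (numVecs ζ b₀ t l k)) := by
  unfold tildeP
  rw [if_neg (by simp)]
  by_cases h : Even k
  · rw [if_pos (by exact_mod_cast h), tau_even h]
    obtain ⟨N, rfl⟩ := h.two_dvd
    rw [Int.toNat_natCast, Nat.mul_div_cancel_left _ two_pos]
    rw [numVecs, wedge_ofFn, schurPf, wick_ιMulti]
    congr 1
    funext r s
    rw [entry_eq_schurForm hα hζ]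
    rfl
  · rw [if_neg (by exact_mod_cast h), tau_odd h]
    obtain ⟨N, rfl⟩ := Nat.not_even_iff_odd.1 h
    rw [Int.toNat_natCast, show 2 * N + 1 + 1 = 2 * (N + 1) by ring,
      Nat.mul_div_cancel_left _ two_pos]
    have hL : d₀ :: numVecs ζ b₀ t l (2 * N + 1) =
        List.ofFn fun r : Fin (2 * (N + 1)) => labelVec ζ b₀ t (labelsOdd l r) := by
      refine Eq.trans ?_ (List.ofFn_succ (n := 2 * N + 1)
        (f := fun r => labelVec ζ b₀ t (labelsOdd l r))).symm
      rfl
    rw [hL, wedge_ofFn, schurPf, wick_ιMulti]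
    congr 1
    funext r s
    rw [entry_eq_schurForm hα hζ]

end Entry

end GenNovikov

/-! ### The tau functions as sums of exponentials -/

namespace GenNovikov

open ExteriorAlgebra

section Tau

variable {n : ℕ} {α : ℝ} {ζ b₀ : Fin n → ℝ}

lemma map_ιMulti_vec {k : ℕ} (T : ExteriorAlgebra ℝ (SchurSpace n) →ₗ[ℝ] ℝ)
    (g : Fin k → Fin n → ℝ) :
    T (ιMulti ℝ k fun r => vec (g r)) =
      ∑ φ : Fin k → Fin n, (∏ r, g r (φ r)) * T (wedge ((List.ofFn φ).map pt)) := by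
  have h := (T.compMultilinearMap (ιMulti ℝ k (M := SchurSpace n)).toMultilinearMap).map_sum
    (fun r p => g r p • pt p)
  have h2 : ∀ φ : Fin k → Fin n, (T.compMultilinearMap
      (ιMulti ℝ k (M := SchurSpace n)).toMultilinearMap) (fun r => g r (φ r) • pt (φ r)) =
      (∏ r, g r (φ r)) * T (wedge ((List.ofFn φ).map pt)) := by
    intro φ
    rw [MultilinearMap.map_smul_univ, smul_eq_mul, List.map_ofFn, wedge_ofFn]
    rfl
  simp_rw [h2] at h
  exact h

lemma wedge_numVecs (t : ℝ) (l : ℤ) (k : ℕ) : wedge (numVecs ζ b₀ t l k) =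
    ιMulti ℝ k fun r : Fin k => vec fun p => ζ p ^ (l + r) * bFun ζ b₀ p t := by
  rw [numVecs, wedge_ofFn]
  rfl

lemma numVecs_succ (t : ℝ) (l : ℤ) (k : ℕ) : numVecs ζ b₀ t l (k + 1) =
    labelVec ζ b₀ t (.num l) :: numVecs ζ b₀ t (l + 1) k := by
  rw [numVecs, List.ofFn_succ, numVecs]
  have h : ∀ r : Fin k, l + ((r.succ : ℕ) : ℤ) = l + 1 + (r : ℕ) := fun r => by
    push_cast [Fin.val_succ]
    ring
  simp only [h, Fin.val_zero, Nat.cast_zero, add_zero]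

lemma numVecs_concat (t : ℝ) (l : ℤ) (k : ℕ) : numVecs ζ b₀ t l (k + 1) =
    numVecs ζ b₀ t l k ++ [labelVec ζ b₀ t (.num (l + k))] := by
  rw [numVecs, List.ofFn_succ_last, numVecs]
  simp

lemma length_numVecs (t : ℝ) (l : ℤ) (k : ℕ) : (numVecs ζ b₀ t l k).length = k := by
  simp [numVecs]

/-- The exponent `∑_r 1 / ζ_{φ r}` of the term of index `φ` of a tau function. -/
noncomputable def rate (ζ : Fin n → ℝ) {k : ℕ} (φ : Fin k → Fin n) : ℝ := ∑ r, (ζ (φ r))⁻¹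

lemma prod_bFun {k : ℕ} (φ : Fin k → Fin n) (t : ℝ) :
    ∏ r, bFun ζ b₀ (φ r) t = (∏ r, b₀ (φ r)) * Real.exp (rate ζ φ * t) := by
  simp only [bFun, Finset.prod_mul_distrib, ← Real.exp_sum, rate, Finset.sum_mul, div_eq_inv_mul]

lemma shifted_pos (hα : 0 ≤ α) (hζ : ∀ p, 0 < ζ p) (p : Fin n) : 0 < shifted α ζ p :=
  add_pos_of_pos_of_nonneg (inv_pos.2 (hζ p)) (by positivity)

lemma shifted_strictAnti (hζ : ∀ p, 0 < ζ p) (hmono : StrictMono ζ) :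
    StrictAnti (shifted α ζ) := fun p q h => by
  unfold shifted
  have := inv_strictAnti₀ (hζ p) (hmono h)
  linarith

/-- The sum over all `φ` reduces to the sum over the injective ones, that is, to ordered
`k`-element subsets, since `kernelProd` vanishes at the others. -/
theorem tildeP_eq_sum (hα : 0 ≤ α) (hζ : ∀ p, 0 < ζ p) (hmono : StrictMono ζ) (l : ℤ) (k : ℕ)
    (t : ℝ) : tildeP α ζ b₀ l k t = ∑ φ : Fin k → Fin n,
      (∏ r : Fin k, ζ (φ r) ^ (l + r) * bFun ζ b₀ (φ r) t) *
        kernelProd (shifted α ζ) (List.ofFn φ) := by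
  rw [tildeP_eq_tau hα hζ, wedge_numVecs, map_ιMulti_vec]
  refine Finset.sum_congr rfl fun φ _ => ?_
  have h := tau_wedge_pt (shifted α ζ) (shifted_pos hα hζ)
    (shifted_strictAnti hζ hmono).injective (List.ofFn φ)
  rw [List.length_ofFn] at h
  rw [h]

theorem tauDot_numVecs_eq_sum (hα : 0 ≤ α) (hζ : ∀ p, 0 < ζ p) (hmono : StrictMono ζ) (l : ℤ)
    (k : ℕ) (t : ℝ) : tauDot (shifted α ζ) k (wedge (numVecs ζ b₀ t l k)) =
      ∑ φ : Fin k → Fin n, (rate ζ φ + k * (α / 2)) *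
      ((∏ r : Fin k, ζ (φ r) ^ (l + r) * bFun ζ b₀ (φ r) t) *
        kernelProd (shifted α ζ) (List.ofFn φ)) := by
  rw [wedge_numVecs, map_ιMulti_vec]
  refine Finset.sum_congr rfl fun φ _ => ?_
  have h := tau_wedge_pt (shifted α ζ) (shifted_pos hα hζ)
    (shifted_strictAnti hζ hmono).injective (List.ofFn φ)
  rw [List.length_ofFn] at h
  rw [tauDot_wedge_pt _ (shifted_pos hα hζ), h]
  have h2 : ((List.ofFn φ).map (shifted α ζ)).sum = rate ζ φ + k * (α / 2) := by
    rw [List.map_ofFn, List.sum_ofFn]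
    simp [shifted, rate, Finset.sum_add_distrib]
  rw [h2]
  ring

lemma hasDerivAt_tildeP_sum (hα : 0 ≤ α) (hζ : ∀ p, 0 < ζ p) (hmono : StrictMono ζ) (l : ℤ)
    (k : ℕ) (t : ℝ) : HasDerivAt (tildeP α ζ b₀ l k) (∑ φ : Fin k → Fin n, rate ζ φ *
      ((∏ r : Fin k, ζ (φ r) ^ (l + r) * bFun ζ b₀ (φ r) t) *
        kernelProd (shifted α ζ) (List.ofFn φ))) t := by
  have hfun : tildeP α ζ b₀ l k = fun t => ∑ φ : Fin k → Fin n,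
      (∏ r : Fin k, ζ (φ r) ^ (l + r) * bFun ζ b₀ (φ r) t) *
        kernelProd (shifted α ζ) (List.ofFn φ) :=
    funext fun t => tildeP_eq_sum hα hζ hmono l k t
  rw [hfun]
  refine HasDerivAt.fun_sum fun φ _ => ?_
  simp_rw [Finset.prod_mul_distrib, prod_bFun]
  have := ((Real.hasDerivAt_exp (rate ζ φ * t)).comp t ((hasDerivAt_id t).const_mul (rate ζ φ)))
  refine (((this.const_mul (∏ r, b₀ (φ r))).const_mul (∏ r : Fin k, ζ (φ r) ^ (l + r))).mul_const
    (kernelProd (shifted α ζ) (List.ofFn φ))).congr_deriv ?_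
  simp
  ring

theorem hasDerivAt_tildeP (hα : 0 ≤ α) (hζ : ∀ p, 0 < ζ p) (hmono : StrictMono ζ) (l : ℤ)
    (k : ℕ) (t : ℝ) : HasDerivAt (tildeP α ζ b₀ l k)
      (tauDot (shifted α ζ) k (wedge (numVecs ζ b₀ t l k))
        - k * (α / 2) * tau (shifted α ζ) k (wedge (numVecs ζ b₀ t l k))) t := by
  refine (hasDerivAt_tildeP_sum hα hζ hmono l k t).congr_deriv ?_
  rw [tauDot_numVecs_eq_sum hα hζ hmono, ← tildeP_eq_tau hα hζ, tildeP_eq_sum hα hζ hmono,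
    Finset.mul_sum, ← Finset.sum_sub_distrib]
  refine Finset.sum_congr rfl fun φ _ => ?_
  ring

/-- Differentiation lowers the labels one at a time; for consecutive labels only the lowering of the
first one leaves the labels distinct. -/
theorem hasDerivAt_tildeP_succ (hα : 0 ≤ α) (hζ : ∀ p, 0 < ζ p) (hmono : StrictMono ζ) (l : ℤ)
    (k : ℕ) (t : ℝ) : HasDerivAt (tildeP α ζ b₀ l (k + 1 : ℕ))
      (tau (shifted α ζ) (k + 1)
        (wedge (labelVec ζ b₀ t (.num (l - 1)) :: numVecs ζ b₀ t (l + 1) k))) t := by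
  refine (hasDerivAt_tildeP_sum hα hζ hmono l (k + 1) t).congr_deriv ?_
  let g : Fin (k + 1) → Fin (k + 1) → Fin n → ℝ := fun r₀ r p =>
    ζ p ^ (if r = r₀ then l + r - 1 else l + r) * bFun ζ b₀ p t
  have hg : ∀ r₀, tau (shifted α ζ) (k + 1) (ιMulti ℝ (k + 1) fun r => vec (g r₀ r)) =
      ∑ φ : Fin (k + 1) → Fin n, (ζ (φ r₀))⁻¹ *
      ((∏ r : Fin (k + 1), ζ (φ r) ^ (l + r) * bFun ζ b₀ (φ r) t) *
        kernelProd (shifted α ζ) (List.ofFn φ)) := by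
    intro r₀
    rw [map_ιMulti_vec]
    refine Finset.sum_congr rfl fun φ _ => ?_
    have h := tau_wedge_pt (shifted α ζ) (shifted_pos hα hζ)
      (shifted_strictAnti hζ hmono).injective (List.ofFn φ)
    rw [List.length_ofFn] at h
    rw [h, ← mul_assoc]
    congr 1
    rw [← Finset.mul_prod_erase _ _ (Finset.mem_univ r₀),
      ← Finset.mul_prod_erase _ (fun r : Fin (k + 1) => ζ (φ r) ^ (l + r) * bFun ζ b₀ (φ r) t)
        (Finset.mem_univ r₀), ← mul_assoc]
    congr 1
    · simp only [g, if_true]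
      rw [zpow_sub_one₀ (hζ _).ne']
      ring
    · refine Finset.prod_congr rfl fun r hr => ?_
      simp only [g, if_neg (Finset.ne_of_mem_erase hr)]
  have hz : ∀ r₀ : Fin k,
      tau (shifted α ζ) (k + 1) (ιMulti ℝ (k + 1) fun r => vec (g r₀.succ r)) = 0 := by
    intro r₀
    have : g r₀.succ r₀.succ = g r₀.succ r₀.castSucc := by
      funext p
      have hne : r₀.castSucc ≠ r₀.succ := (Fin.castSucc_lt_succ).ne
      simp only [g, if_true, if_neg hne]
      congr 2
      simp
      ring
    rw [AlternatingMap.map_eq_zero_of_eq _ _ (i := r₀.succ) (j := r₀.castSucc) (by rw [this])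
      (Fin.castSucc_lt_succ).ne', map_zero]
  have h0 : ∑ r₀ : Fin (k + 1), tau (shifted α ζ) (k + 1)
      (ιMulti ℝ (k + 1) fun r => vec (g r₀ r)) =
      tau (shifted α ζ) (k + 1)
        (wedge (labelVec ζ b₀ t (.num (l - 1)) :: numVecs ζ b₀ t (l + 1) k)) := by
    rw [Fin.sum_univ_succ, Finset.sum_eq_zero fun r₀ _ => hz r₀, add_zero, ← wedge_ofFn,
      List.ofFn_succ]
    congr 3
    · simp [g, labelVec]
    · simp only [numVecs, labelVec, g]
      congr 1
      funext r
      have h : l + ((r.succ : ℕ) : ℤ) = l + 1 + (r : ℕ) := by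
        push_cast [Fin.val_succ]
        ring
      simp only [h, if_neg (Fin.succ_ne_zero r)]
  rw [← h0]
  simp_rw [hg]
  rw [Finset.sum_comm]
  refine Finset.sum_congr rfl fun φ _ => ?_
  rw [← Finset.sum_mul]
  rfl

/-- The bilinear relation between the tau functions of base `l` and `l + 1`. -/
theorem tildeP_bilinear_dot (hα : 0 ≤ α) (hζ : ∀ p, 0 < ζ p) (hmono : StrictMono ζ) (l : ℤ)
    (k : ℕ) (t : ℝ) :
    deriv (tildeP α ζ b₀ l (k + 2 : ℕ)) t * tildeP α ζ b₀ (l + 1) k t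
        - tildeP α ζ b₀ l (k + 2 : ℕ) t * deriv (tildeP α ζ b₀ (l + 1) k) t
        + α * tildeP α ζ b₀ l (k + 2 : ℕ) t * tildeP α ζ b₀ (l + 1) k t =
      deriv (tildeP α ζ b₀ l (k + 1 : ℕ)) t * tildeP α ζ b₀ (l + 1) (k + 1 : ℕ) t
        - tildeP α ζ b₀ l (k + 1 : ℕ) t * deriv (tildeP α ζ b₀ (l + 1) (k + 1 : ℕ)) t := by
  simp only [(hasDerivAt_tildeP hα hζ hmono _ _ t).deriv, tildeP_eq_tau hα hζ]
  set X := numVecs ζ b₀ t (l + 1) k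
  set p := labelVec ζ b₀ t (.num l)
  set q := labelVec ζ b₀ t (.num (l + 1 + k))
  have h1 : wedge (numVecs ζ b₀ t (l + 1) (k + 1)) = (-1 : ℝ) ^ k • wedge (q :: X) := by
    rw [numVecs_concat, wedge_append_singleton, length_numVecs]
  have h2 : wedge (numVecs ζ b₀ t l (k + 2)) = (-1 : ℝ) ^ k • wedge (p :: q :: X) := by
    rw [numVecs_succ, wedge_cons, h1, mul_smul_comm, ← wedge_cons]
  have h3 : numVecs ζ b₀ t l (k + 1) = p :: X := numVecs_succ _ _ _
  have b := tau_bilinear_dot (shifted α ζ) k X p q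
  rw [h1, h2, h3]
  simp only [map_smul, smul_eq_mul, tau_add_two, tauDot_add_two]
  push_cast
  linear_combination (-1) ^ k * b

/-- The bilinear relation between the tau functions of base `l`, `l + 1` and `l + 2`. -/
theorem tildeP_bilinear_three (hα : 0 ≤ α) (hζ : ∀ p, 0 < ζ p) (hmono : StrictMono ζ) (l : ℤ)
    (k : ℕ) (t : ℝ) :
    tildeP α ζ b₀ (l + 2) (k + 1 : ℕ) t * tildeP α ζ b₀ l (k + 2 : ℕ) t
        - tildeP α ζ b₀ l (k + 3 : ℕ) t * tildeP α ζ b₀ (l + 2) k t =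
      deriv (tildeP α ζ b₀ (l + 1) (k + 2 : ℕ)) t * tildeP α ζ b₀ (l + 1) (k + 1 : ℕ) t
        - tildeP α ζ b₀ (l + 1) (k + 2 : ℕ) t * deriv (tildeP α ζ b₀ (l + 1) (k + 1 : ℕ)) t := by
  have e1 := (hasDerivAt_tildeP_succ (b₀ := b₀) hα hζ hmono (l + 1) (k + 1) t).deriv
  have e2 := (hasDerivAt_tildeP_succ (b₀ := b₀) hα hζ hmono (l + 1) k t).deriv
  rw [e1, e2]
  simp only [tildeP_eq_tau hα hζ]
  rw [show l + 1 + 1 = l + 2 by ring, show l + 1 - 1 = l by ring]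
  set X := numVecs ζ b₀ t (l + 2) k
  set p := labelVec ζ b₀ t (.num l)
  set p' := labelVec ζ b₀ t (.num (l + 1))
  set q := labelVec ζ b₀ t (.num (l + 2 + k))
  have h1 : wedge (numVecs ζ b₀ t (l + 2) (k + 1)) = (-1 : ℝ) ^ k • wedge (q :: X) := by
    rw [numVecs_concat, wedge_append_singleton, length_numVecs]
  have h2 : wedge (numVecs ζ b₀ t (l + 1) (k + 2)) = (-1 : ℝ) ^ k • wedge (p' :: q :: X) := by
    rw [numVecs_succ, show l + 1 + 1 = l + 2 by ring, wedge_cons, h1, mul_smul_comm, ← wedge_cons]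
  have h3 : wedge (numVecs ζ b₀ t l (k + 3)) = (-1 : ℝ) ^ k • wedge (p :: p' :: q :: X) := by
    rw [numVecs_succ, wedge_cons, h2, mul_smul_comm, ← wedge_cons]
  have h4 : numVecs ζ b₀ t (l + 1) (k + 1) = p' :: X := by
    rw [numVecs_succ, show l + 1 + 1 = l + 2 by ring]
  have h5 : numVecs ζ b₀ t l (k + 2) = p :: p' :: X := by
    rw [numVecs_succ, h4]
  have h6 : wedge (p :: numVecs ζ b₀ t (l + 2) (k + 1)) = (-1 : ℝ) ^ k • wedge (p :: q :: X) := by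
    rw [wedge_cons, h1, mul_smul_comm, ← wedge_cons]
  have b := tau_bilinear_three (shifted α ζ) k X p p' q
  rw [h1, h2, h3, h4, h5, h6]
  simp only [map_smul, smul_eq_mul, tau_add_two, show k + 1 + 1 = k + 2 from rfl,
    show k + 3 = k + 1 + 2 from rfl]
  linear_combination (-1) ^ k * b

end Tau

end GenNovikov

/-! ### Positivity of the tau functions and their behaviour at `-∞` -/

namespace GenNovikov

open Filter Topology

section Positivity

variable {n : ℕ} {α : ℝ} {ζ b₀ : Fin n → ℝ}

lemma kernelProd_ofFn (μ : Fin n → ℝ) {k : ℕ} (φ : Fin k → Fin n) :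
    kernelProd μ (List.ofFn φ) = ∏ i, ∏ j ∈ Finset.Ioi i, kernel μ (φ i) (φ j) := by
  induction k with
  | zero => simp [kernelProd]
  | succ k ih =>
    rw [List.ofFn_succ, kernelProd, ih, Fin.prod_univ_succ, List.map_ofFn, List.prod_ofFn,
      Fin.prod_Ioi_zero]
    simp_rw [Fin.prod_Ioi_succ]
    rfl

/-- The coefficient of `e^{rate φ t}` in the symmetrised expansion of a tau function. -/
noncomputable def symmCoeff (α : ℝ) (ζ b₀ : Fin n → ℝ) (l : ℤ) {k : ℕ} (φ : Fin k → Fin n) : ℝ :=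
  (∏ r, ζ (φ r) ^ l * b₀ (φ r)) *
    ∏ i, ∏ j ∈ Finset.Ioi i, kernel (shifted α ζ) (φ i) (φ j) * (ζ (φ j) - ζ (φ i))

/-- Averaging the expansion over the permutations of the index `φ` produces a Vandermonde
determinant. -/
theorem factorial_mul_tildeP (hα : 0 ≤ α) (hζ : ∀ p, 0 < ζ p) (hmono : StrictMono ζ) (l : ℤ)
    (k : ℕ) (t : ℝ) : (k.factorial : ℝ) * tildeP α ζ b₀ l k t =
      ∑ φ : Fin k → Fin n, symmCoeff α ζ b₀ l φ * Real.exp (rate ζ φ * t) := by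
  set c : (Fin k → Fin n) → ℝ := fun φ => (∏ r : Fin k, ζ (φ r) ^ (l + r) * bFun ζ b₀ (φ r) t) *
    kernelProd (shifted α ζ) (List.ofFn φ) with hc
  have h1 : ∀ σ : Equiv.Perm (Fin k), ∑ φ : Fin k → Fin n, c (φ ∘ σ) = tildeP α ζ b₀ l k t := by
    intro σ
    rw [tildeP_eq_sum hα hζ hmono]
    exact Equiv.sum_comp (σ.symm.arrowCongr (Equiv.refl (Fin n))) c
  have h2 : (k.factorial : ℝ) * tildeP α ζ b₀ l k t =
      ∑ σ : Equiv.Perm (Fin k), ∑ φ : Fin k → Fin n, c (φ ∘ σ) := by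
    simp_rw [h1]
    simp [Fintype.card_perm]
  rw [h2, Finset.sum_comm]
  refine Finset.sum_congr rfl fun φ _ => ?_
  have h3 : ∀ σ : Equiv.Perm (Fin k), c (φ ∘ σ) =
      ((∏ r, ζ (φ r) ^ l * bFun ζ b₀ (φ r) t) *
        ∏ i, ∏ j ∈ Finset.Ioi i, kernel (shifted α ζ) (φ i) (φ j)) *
      (((Equiv.Perm.sign σ : ℤ) : ℝ) * ∏ r : Fin k, ζ (φ (σ r)) ^ (r : ℕ)) := by
    intro σ
    simp only [hc, kernelProd_ofFn, Function.comp_apply]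
    rw [σ.prod_Ioi_comp_eq_sign_mul_prod
      (f := fun i j => kernel (shifted α ζ) (φ i) (φ j)) fun i j => kernel_antisymm _ _ _]
    rw [← Equiv.prod_comp σ fun r => ζ (φ r) ^ l * bFun ζ b₀ (φ r) t]
    simp_rw [zpow_add₀ (hζ _).ne', zpow_natCast, Finset.prod_mul_distrib]
    ring
  simp_rw [h3]
  rw [← Finset.mul_sum]
  have h4 : ∑ σ : Equiv.Perm (Fin k), ((Equiv.Perm.sign σ : ℤ) : ℝ) *
      ∏ r : Fin k, ζ (φ (σ r)) ^ (r : ℕ) =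
      ∏ i : Fin k, ∏ j ∈ Finset.Ioi i, (ζ (φ j) - ζ (φ i)) := by
    rw [← Matrix.det_vandermonde fun i => ζ (φ i), Matrix.det_apply']
    simp [Matrix.vandermonde_apply]
  rw [h4]
  simp only [symmCoeff, Finset.prod_mul_distrib, prod_bFun]
  ring

lemma kernel_mul_sub_pos (hα : 0 ≤ α) (hζ : ∀ p, 0 < ζ p) (hmono : StrictMono ζ) {p q : Fin n}
    (h : p ≠ q) : 0 < kernel (shifted α ζ) p q * (ζ q - ζ p) := by
  have key : ∀ p q : Fin n, p < q → 0 < kernel (shifted α ζ) p q * (ζ q - ζ p) := by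
    intro p q h
    refine mul_pos (div_pos ?_ (add_pos (shifted_pos hα hζ p) (shifted_pos hα hζ q)))
      (sub_pos.2 (hmono h))
    exact sub_pos.2 (shifted_strictAnti hζ hmono h)
  rcases lt_or_gt_of_ne h with h | h
  · exact key p q h
  · have := key q p h
    rw [kernel_antisymm] at this
    linarith

lemma symmCoeff_pos (hα : 0 ≤ α) (hζ : ∀ p, 0 < ζ p) (hmono : StrictMono ζ) (hb : ∀ p, 0 < b₀ p)
    (l : ℤ) {k : ℕ} {φ : Fin k → Fin n} (hφ : Function.Injective φ) :
    0 < symmCoeff α ζ b₀ l φ := by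
  refine mul_pos (Finset.prod_pos fun r _ => mul_pos (zpow_pos (hζ _) _) (hb _))
    (Finset.prod_pos fun i _ => Finset.prod_pos fun j hj => ?_)
  exact kernel_mul_sub_pos hα hζ hmono (hφ.ne (Finset.mem_Ioi.1 hj).ne)

lemma symmCoeff_eq_zero (l : ℤ) {k : ℕ} {φ : Fin k → Fin n} (hφ : ¬Function.Injective φ) :
    symmCoeff α ζ b₀ l φ = 0 := by
  have : ∃ i j, i < j ∧ φ i = φ j := by
    simp only [Function.Injective, not_forall] at hφ
    obtain ⟨i, j, h, hij⟩ := hφ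
    rcases lt_or_gt_of_ne hij with h' | h'
    · exact ⟨i, j, h', h⟩
    · exact ⟨j, i, h', h.symm⟩
  obtain ⟨i, j, hij, h⟩ := this
  refine mul_eq_zero_of_right _ (Finset.prod_eq_zero (Finset.mem_univ i)
    (Finset.prod_eq_zero (Finset.mem_Ioi.2 hij) ?_))
  rw [h, sub_self, mul_zero]

lemma symmCoeff_nonneg (hα : 0 ≤ α) (hζ : ∀ p, 0 < ζ p) (hmono : StrictMono ζ)
    (hb : ∀ p, 0 < b₀ p) (l : ℤ) {k : ℕ} (φ : Fin k → Fin n) : 0 ≤ symmCoeff α ζ b₀ l φ := by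
  by_cases hφ : Function.Injective φ
  · exact (symmCoeff_pos hα hζ hmono hb l hφ).le
  · exact (symmCoeff_eq_zero l hφ).ge

/-- The `k` largest indices, in decreasing order. -/
def topIndices {n k : ℕ} (h : k ≤ n) (r : Fin k) : Fin n := Fin.rev (Fin.castLE h r)

lemma topIndices_injective {k : ℕ} (h : k ≤ n) : Function.Injective (topIndices h) :=
  Fin.rev_injective.comp (Fin.castLE_injective h)

theorem tildeP_pos (hα : 0 ≤ α) (hζ : ∀ p, 0 < ζ p) (hmono : StrictMono ζ) (hb : ∀ p, 0 < b₀ p)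
    (l : ℤ) {k : ℕ} (hk : k ≤ n) (t : ℝ) : 0 < tildeP α ζ b₀ l k t := by
  refine pos_of_mul_pos_right (?_ : 0 < (k.factorial : ℝ) * _) (Nat.cast_nonneg _)
  rw [factorial_mul_tildeP hα hζ hmono]
  refine Finset.sum_pos' (fun φ _ => mul_nonneg (symmCoeff_nonneg hα hζ hmono hb l φ)
    (Real.exp_pos _).le) ⟨topIndices hk, Finset.mem_univ _, ?_⟩
  exact mul_pos (symmCoeff_pos hα hζ hmono hb l (topIndices_injective hk)) (Real.exp_pos _)

theorem tildeP_eq_zero (hα : 0 ≤ α) (hζ : ∀ p, 0 < ζ p) (hmono : StrictMono ζ)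
    (l : ℤ) {k : ℕ} (hk : n < k) (t : ℝ) : tildeP α ζ b₀ l k t = 0 := by
  refine (mul_eq_zero.1 ?_).resolve_left (Nat.cast_ne_zero.2 k.factorial_ne_zero : (k.factorial : ℝ) ≠ 0)
  rw [factorial_mul_tildeP hα hζ hmono]
  refine Finset.sum_eq_zero fun φ _ => ?_
  rw [symmCoeff_eq_zero, zero_mul]
  intro hφ
  have := Fintype.card_le_of_injective φ hφ
  simp at this
  omega

/-- The smallest exponent of a tau function: the sum of the `k` smallest inverses `1 / ζ_p`. -/
noncomputable def minRate (ζ : Fin n → ℝ) {k : ℕ} (h : k ≤ n) : ℝ := rate ζ (topIndices h)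

lemma minRate_succ {k : ℕ} (h : k + 1 ≤ n) : minRate ζ h =
    minRate ζ (Nat.le_of_succ_le h) + (ζ (Fin.rev ⟨k, h⟩))⁻¹ := by
  unfold minRate rate
  rw [Fin.sum_univ_castSucc]
  rfl

lemma minRate_le (hζ : ∀ p, 0 < ζ p) (hmono : StrictMono ζ) {k : ℕ} (h : k ≤ n) {φ : Fin k → Fin n}
    (hφ : Function.Injective φ) : minRate ζ h ≤ rate ζ φ := by
  induction k with
  | zero => simp [minRate, rate]
  | succ k ih =>
    -- by counting, one of the `k + 1` indices is not among the `k` largest ones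
    have hex : ∃ r, φ r ≤ Fin.rev ⟨k, h⟩ := by
      by_contra! hcon
      have hc : (Finset.univ.image φ).card ≤ (Finset.Ioi (Fin.rev ⟨k, h⟩)).card := by
        refine Finset.card_le_card fun p hp => ?_
        obtain ⟨r, _, rfl⟩ := Finset.mem_image.1 hp
        exact Finset.mem_Ioi.2 (hcon r)
      rw [Finset.card_image_of_injective _ hφ, Finset.card_univ, Fintype.card_fin, Fin.card_Ioi,
        Fin.val_rev] at hc
      simp at hc
      omega
    obtain ⟨r, hr⟩ := hex
    have h1 := ih (Nat.le_of_succ_le h) (hφ.comp Fin.succAbove_right_injective : Function.Injective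
      (φ ∘ r.succAbove))
    have h2 : rate ζ φ = (ζ (φ r))⁻¹ + rate ζ (φ ∘ r.succAbove) := by
      unfold rate
      rw [Fin.sum_univ_succAbove _ r]
      rfl
    have h3 : (ζ (Fin.rev ⟨k, h⟩))⁻¹ ≤ (ζ (φ r))⁻¹ := inv_anti₀ (hζ _) (hmono.monotone hr)
    rw [minRate_succ, h2]
    linarith

lemma exists_tendsto_atBot (hα : 0 ≤ α) (hζ : ∀ p, 0 < ζ p) (hmono : StrictMono ζ)
    (hb : ∀ p, 0 < b₀ p) (l : ℤ) {k : ℕ} (hk : k ≤ n) :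
    ∃ L, 0 < L ∧
      Tendsto (fun t => tildeP α ζ b₀ l k t * Real.exp (-(minRate ζ hk * t))) atBot (𝓝 L) := by
  have hterm : ∀ φ : Fin k → Fin n, Tendsto
      (fun t => symmCoeff α ζ b₀ l φ * Real.exp ((rate ζ φ - minRate ζ hk) * t)) atBot
      (𝓝 (if rate ζ φ = minRate ζ hk then symmCoeff α ζ b₀ l φ else 0)) := by
    intro φ
    split_ifs with he
    · simp [he]
    · by_cases hφ : Function.Injective φ
      · have hlt : 0 < rate ζ φ - minRate ζ hk :=
          sub_pos.2 (lt_of_le_of_ne (minRate_le hζ hmono hk hφ) (Ne.symm he))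
        simpa using (Real.tendsto_exp_atBot.comp
          (tendsto_id.const_mul_atBot hlt)).const_mul (symmCoeff α ζ b₀ l φ)
      · simp [symmCoeff_eq_zero l hφ]
  have hsum := (tendsto_finsetSum Finset.univ fun φ _ => hterm φ).const_mul
    ((k.factorial : ℝ)⁻¹)
  refine ⟨_, ?_, hsum.congr fun t => ?_⟩
  · refine mul_pos (inv_pos.2 (Nat.cast_pos.2 k.factorial_pos)) (Finset.sum_pos' (fun φ _ => ?_)
      ⟨topIndices hk, Finset.mem_univ _, ?_⟩)
    · split_ifs
      · exact symmCoeff_nonneg hα hζ hmono hb l φ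
      · exact le_rfl
    · rw [if_pos (show rate ζ (topIndices hk) = minRate ζ hk from rfl)]
      exact symmCoeff_pos hα hζ hmono hb l (topIndices_injective hk)
  · have hf : (k.factorial : ℝ) ≠ 0 := Nat.cast_ne_zero.2 k.factorial_ne_zero
    rw [inv_mul_eq_iff_eq_mul₀ hf, ← mul_assoc, factorial_mul_tildeP hα hζ hmono, Finset.sum_mul]
    refine Finset.sum_congr rfl fun φ _ => ?_
    rw [mul_assoc, ← Real.exp_add]
    ring_nf

lemma tildeP_neg (l : ℤ) {k : ℤ} (hk : k < 0) (t : ℝ) : tildeP α ζ b₀ l k t = 0 := by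
  simp [tildeP, hk]

lemma tildeP_zero (l : ℤ) (t : ℝ) : tildeP α ζ b₀ l 0 t = 1 := by
  unfold tildeP
  rw [if_neg (by simp), if_pos (by simp)]
  exact pfaffian_zero _

/-- The quadratic expression `P_k(l) P_k(l+1) - P_{k+1}(l) P_{k-1}(l+1)`; it is `Z_k` for `l = -1`
and `W_k` for `l = 0`. -/
noncomputable def minor (α : ℝ) (ζ b₀ : Fin n → ℝ) (l k : ℤ) (t : ℝ) : ℝ :=
  tildeP α ζ b₀ l k t * tildeP α ζ b₀ (l + 1) k t
    - tildeP α ζ b₀ l (k + 1) t * tildeP α ζ b₀ (l + 1) (k - 1) t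

lemma minor_zero (l : ℤ) (t : ℝ) : minor α ζ b₀ l 0 t = 1 := by
  simp [minor, tildeP_zero, tildeP_neg]

/-- As `t → -∞` the first product in `minor` dominates, because the smallest exponents of the tau
functions are strictly convex in `k`. -/
lemma eventually_minor_pos (hα : 0 ≤ α) (hζ : ∀ p, 0 < ζ p) (hmono : StrictMono ζ)
    (hb : ∀ p, 0 < b₀ p) (l : ℤ) {k : ℕ} (hk : k + 1 ≤ n) :
    ∀ᶠ t in atBot, 0 < minor α ζ b₀ l (k + 1 : ℕ) t := by
  rcases Nat.lt_or_ge n (k + 2) with h | h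
  · refine Eventually.of_forall fun t => ?_
    have h0 := tildeP_eq_zero (b₀ := b₀) hα hζ hmono l h t
    have : minor α ζ b₀ l (k + 1 : ℕ) t =
        tildeP α ζ b₀ l (k + 1 : ℕ) t * tildeP α ζ b₀ (l + 1) (k + 1 : ℕ) t := by
      rw [minor, show (((k + 1 : ℕ) : ℤ) + 1) = ((k + 2 : ℕ) : ℤ) by push_cast; ring, h0]
      ring
    rw [this]
    exact mul_pos (tildeP_pos hα hζ hmono hb l hk t) (tildeP_pos hα hζ hmono hb (l + 1) hk t)
  · obtain ⟨L1, p1, h1⟩ := exists_tendsto_atBot hα hζ hmono hb l hk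
    obtain ⟨L2, p2, h2⟩ := exists_tendsto_atBot hα hζ hmono hb (l + 1) hk
    obtain ⟨L3, p3, h3⟩ := exists_tendsto_atBot hα hζ hmono hb l h
    obtain ⟨L4, p4, h4⟩ := exists_tendsto_atBot hα hζ hmono hb (l + 1) (Nat.le_of_succ_le hk)
    set d : ℝ := (ζ (Fin.rev ⟨k + 1, h⟩))⁻¹ - (ζ (Fin.rev ⟨k, hk⟩))⁻¹ with hd
    have hdpos : 0 < d := by
      refine sub_pos.2 (inv_strictAnti₀ (hζ _) (hmono ?_))
      rw [Fin.rev_lt_rev]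
      simp [Fin.lt_def]
    have hexp : Tendsto (fun t => Real.exp (d * t)) atBot (𝓝 0) :=
      Real.tendsto_exp_atBot.comp (tendsto_id.const_mul_atBot hdpos)
    have hlim := (h1.mul h2).sub ((h3.mul h4).mul hexp)
    rw [mul_zero, sub_zero] at hlim
    filter_upwards [hlim.eventually_const_lt (mul_pos p1 p2)] with t ht
    refine pos_of_mul_pos_left (b := Real.exp (-(2 * minRate ζ hk * t))) ?_ (Real.exp_pos _).le
    refine ht.trans_eq ?_
    have e1 : Real.exp (-(minRate ζ hk * t)) * Real.exp (-(minRate ζ hk * t)) =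
        Real.exp (-(2 * minRate ζ hk * t)) := by
      rw [← Real.exp_add]
      ring_nf
    have e2 : Real.exp (-(minRate ζ h * t)) * Real.exp (-(minRate ζ (Nat.le_of_succ_le hk) * t)) *
        Real.exp (d * t) = Real.exp (-(2 * minRate ζ hk * t)) := by
      rw [← Real.exp_add, ← Real.exp_add, hd, minRate_succ h, minRate_succ hk]
      ring_nf
    rw [minor, show (((k + 1 : ℕ) : ℤ) + 1) = ((k + 2 : ℕ) : ℤ) by push_cast; ring,
      show (((k + 1 : ℕ) : ℤ) - 1) = (k : ℤ) by push_cast; ring]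
    linear_combination (tildeP α ζ b₀ l (k + 1 : ℕ) t * tildeP α ζ b₀ (l + 1) (k + 1 : ℕ) t) * e1
      - (tildeP α ζ b₀ l (k + 2 : ℕ) t * tildeP α ζ b₀ (l + 1) k t) * e2

end Positivity

end GenNovikov

/-! ### Differential equations and positivity of `Z` and `W` -/

namespace GenNovikov

open Filter Topology

/-- A differentiable function that is positive near `-∞` and increasing at each of its zeros is
positive. -/
lemma pos_of_deriv_pos_at_zeros {f f' : ℝ → ℝ} (hf : ∀ t, HasDerivAt f (f' t) t)
    (hbot : ∀ᶠ t in atBot, 0 < f t) (hzero : ∀ t, f t = 0 → 0 < f' t) (t : ℝ) : 0 < f t := by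
  by_contra! hneg
  obtain ⟨T, hT⟩ := eventually_atBot.1 hbot
  have hcont : Continuous f := continuous_iff_continuousAt.2 fun t => (hf t).continuousAt
  have hTt : T ≤ t := by
    by_contra! h
    exact absurd (hT t h.le) hneg.not_gt
  -- the first point `s` at which `f` is not positive
  obtain ⟨s, ⟨⟨hTs, hst⟩, hs⟩, hmin⟩ :=
    (isCompact_Icc.inter_right (isClosed_le hcont continuous_const) :
      IsCompact (Set.Icc T t ∩ {s | f s ≤ 0})).exists_isLeast ⟨t, ⟨hTt, le_rfl⟩, hneg⟩
  have hpos : ∀ r < s, 0 < f r := by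
    intro r hr
    rcases le_or_gt r T with h | h
    · exact hT r h
    · by_contra! hc
      exact absurd (hmin ⟨⟨h.le, hr.le.trans hst⟩, hc⟩) hr.not_ge
  have hs0 : f s = 0 := by
    refine le_antisymm hs (ge_of_tendsto (hcont.continuousAt.tendsto.mono_left nhdsWithin_le_nhds :
      Tendsto f (𝓝[<] s) (𝓝 (f s))) ?_)
    filter_upwards [self_mem_nhdsWithin] with r hr using (hpos r hr).le
  have hslope : Tendsto (slope f s) (𝓝[<] s) (𝓝 (f' s)) :=
    (hasDerivAt_iff_tendsto_slope.1 (hf s)).mono_left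
      (nhdsWithin_mono _ fun r (hr : r < s) => hr.ne)
  have hle : f' s ≤ 0 := by
    refine le_of_tendsto hslope ?_
    filter_upwards [self_mem_nhdsWithin] with r hr
    rw [slope_def_field, hs0, sub_zero]
    exact div_nonpos_of_nonneg_of_nonpos (hpos r hr).le (sub_nonpos.2 (le_of_lt hr))
  exact absurd (hzero s hs0) hle.not_gt

section Dynamics

variable {n : ℕ} {α : ℝ} {ζ b₀ : Fin n → ℝ}

lemma tildeP_hasDerivAt_deriv (hα : 0 ≤ α) (hζ : ∀ p, 0 < ζ p) (hmono : StrictMono ζ) (l k : ℤ)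
    (t : ℝ) : HasDerivAt (tildeP α ζ b₀ l k) (deriv (tildeP α ζ b₀ l k) t) t := by
  rcases lt_or_ge k 0 with h | h
  · have : tildeP α ζ b₀ l k = fun _ => 0 := funext fun t => tildeP_neg l h t
    rw [this]
    exact (differentiableAt_const _).hasDerivAt
  · lift k to ℕ using h
    exact (hasDerivAt_tildeP hα hζ hmono l k t).differentiableAt.hasDerivAt

lemma deriv_tildeP_zero (l : ℤ) (t : ℝ) : deriv (tildeP α ζ b₀ l 0) t = 0 := by
  have : tildeP α ζ b₀ l 0 = fun _ => 1 := funext fun t => tildeP_zero l t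
  rw [this, deriv_const]

/-- The first bilinear relation, for all orders. -/
lemma bilinear_dot (hα : 0 ≤ α) (hζ : ∀ p, 0 < ζ p) (hmono : StrictMono ζ) (l : ℤ) {k : ℤ}
    (hk : 0 ≤ k) (t : ℝ) :
    deriv (tildeP α ζ b₀ l (k + 1)) t * tildeP α ζ b₀ (l + 1) (k - 1) t
        - tildeP α ζ b₀ l (k + 1) t * deriv (tildeP α ζ b₀ (l + 1) (k - 1)) t
        + α * tildeP α ζ b₀ l (k + 1) t * tildeP α ζ b₀ (l + 1) (k - 1) t =
      deriv (tildeP α ζ b₀ l k) t * tildeP α ζ b₀ (l + 1) k t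
        - tildeP α ζ b₀ l k t * deriv (tildeP α ζ b₀ (l + 1) k) t := by
  lift k to ℕ using hk
  cases k with
  | zero =>
    have : tildeP α ζ b₀ (l + 1) (-1) = fun _ => 0 :=
      funext fun t => tildeP_neg _ (by norm_num) t
    simp [deriv_tildeP_zero, this]
  | succ k =>
    have h := tildeP_bilinear_dot (b₀ := b₀) hα hζ hmono l k t
    rw [show (((k + 1 : ℕ) : ℤ) + 1) = ((k + 2 : ℕ) : ℤ) by push_cast; ring,
      show (((k + 1 : ℕ) : ℤ) - 1) = (k : ℤ) by push_cast; ring]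
    exact h

/-- The second bilinear relation, for all positive orders. -/
lemma bilinear_three (hα : 0 ≤ α) (hζ : ∀ p, 0 < ζ p) (hmono : StrictMono ζ) (l : ℤ) {k : ℤ}
    (hk : 1 ≤ k) (t : ℝ) :
    tildeP α ζ b₀ (l + 2) (k - 1) t * tildeP α ζ b₀ l k t
        - tildeP α ζ b₀ l (k + 1) t * tildeP α ζ b₀ (l + 2) (k - 2) t =
      deriv (tildeP α ζ b₀ (l + 1) k) t * tildeP α ζ b₀ (l + 1) (k - 1) t
        - tildeP α ζ b₀ (l + 1) k t * deriv (tildeP α ζ b₀ (l + 1) (k - 1)) t := by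
  obtain ⟨k, rfl⟩ : ∃ j : ℕ, k = (j + 1 : ℕ) := ⟨(k - 1).toNat, by omega⟩
  cases k with
  | zero =>
    have h1 := (hasDerivAt_tildeP_succ (b₀ := b₀) hα hζ hmono (l + 1) 0 t).deriv
    have h2 := tildeP_eq_tau (b₀ := b₀) hα hζ l 1 t
    rw [numVecs_succ] at h2
    simp only [zero_add, Nat.cast_one, add_sub_cancel_right] at h1 h2 ⊢
    have h3 : ∀ l, numVecs ζ b₀ t l 0 = [] := fun _ => rfl
    rw [h3] at h1 h2
    rw [h1, ← h2]
    simp [tildeP_zero, tildeP_neg, deriv_tildeP_zero]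
  | succ k =>
    have h := tildeP_bilinear_three (b₀ := b₀) hα hζ hmono l k t
    rw [show (((k + 1 + 1 : ℕ) : ℤ) + 1) = ((k + 3 : ℕ) : ℤ) by push_cast; ring,
      show (((k + 1 + 1 : ℕ) : ℤ) - 1) = ((k + 1 : ℕ) : ℤ) by push_cast; ring,
      show (((k + 1 + 1 : ℕ) : ℤ) - 2) = (k : ℤ) by push_cast; ring]
    exact h

/-- The derivative of `minor`, with the derivatives of the first factors eliminated. -/
lemma hasDerivAt_minor (hα : 0 ≤ α) (hζ : ∀ p, 0 < ζ p) (hmono : StrictMono ζ) (l : ℤ) {k : ℤ}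
    (hk : 0 ≤ k) (t : ℝ) : HasDerivAt (minor α ζ b₀ l k)
      (2 * tildeP α ζ b₀ l k t * deriv (tildeP α ζ b₀ (l + 1) k) t
        - 2 * tildeP α ζ b₀ l (k + 1) t * deriv (tildeP α ζ b₀ (l + 1) (k - 1)) t
        + α * tildeP α ζ b₀ l (k + 1) t * tildeP α ζ b₀ (l + 1) (k - 1) t) t := by
  have d := fun l k => tildeP_hasDerivAt_deriv (b₀ := b₀) hα hζ hmono l k t
  refine (((d l k).mul (d (l + 1) k)).sub ((d l (k + 1)).mul (d (l + 1) (k - 1)))).congr_deriv ?_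
  linear_combination -bilinear_dot (b₀ := b₀) hα hζ hmono l hk t

/-- The derivative of `minor`, with the derivatives of the second factors eliminated. -/
lemma hasDerivAt_minor' (hα : 0 ≤ α) (hζ : ∀ p, 0 < ζ p) (hmono : StrictMono ζ) (l : ℤ) {k : ℤ}
    (hk : 0 ≤ k) (t : ℝ) : HasDerivAt (minor α ζ b₀ l k)
      (2 * tildeP α ζ b₀ (l + 1) k t * deriv (tildeP α ζ b₀ l k) t
        - 2 * tildeP α ζ b₀ (l + 1) (k - 1) t * deriv (tildeP α ζ b₀ l (k + 1)) t
        - α * tildeP α ζ b₀ l (k + 1) t * tildeP α ζ b₀ (l + 1) (k - 1) t) t := by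
  refine (hasDerivAt_minor hα hζ hmono l hk t).congr_deriv ?_
  linear_combination 2 * bilinear_dot (b₀ := b₀) hα hζ hmono l hk t

theorem minor_pos (hα : 0 ≤ α) (hζ : ∀ p, 0 < ζ p) (hmono : StrictMono ζ) (hb : ∀ p, 0 < b₀ p)
    {k : ℕ} (hk : k ≤ n) (l : ℤ) (t : ℝ) : 0 < minor α ζ b₀ l k t := by
  induction k generalizing l t with
  | zero => rw [Nat.cast_zero, minor_zero]; exact one_pos
  | succ k ih =>
    have hk0 : (0 : ℤ) ≤ (k + 1 : ℕ) := by positivity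
    refine pos_of_deriv_pos_at_zeros (fun t => hasDerivAt_minor hα hζ hmono l hk0 t)
      (eventually_minor_pos hα hζ hmono hb l hk) (fun s hs => ?_) t
    have hW := ih (Nat.le_of_succ_le hk) (l + 1) s
    have hab := bilinear_three (b₀ := b₀) hα hζ hmono l (k := (k + 1 : ℕ)) (by simp) s
    have hA := tildeP_pos hα hζ hmono hb (l + 1) hk s
    have ha := tildeP_pos hα hζ hmono hb l hk s
    have hB := tildeP_pos hα hζ hmono hb (l + 1) (Nat.le_of_succ_le hk) s
    rw [minor] at hs hW
    rw [show (((k + 1 : ℕ) : ℤ) - 1) = (k : ℤ) by push_cast; ring] at hs hab ⊢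
    rw [show (((k + 1 : ℕ) : ℤ) - 2) = (k : ℤ) - 1 by push_cast; ring] at hab
    rw [show ((k : ℤ) + 1) = ((k + 1 : ℕ) : ℤ) by push_cast; ring,
      show l + 1 + 1 = l + 2 by ring] at hW
    generalize tildeP α ζ b₀ l (k + 1 : ℕ) s = a at *
    generalize tildeP α ζ b₀ l ((k + 1 : ℕ) + 1) s = C at *
    generalize tildeP α ζ b₀ (l + 1) (k + 1 : ℕ) s = A at *
    generalize tildeP α ζ b₀ (l + 1) k s = b at *
    generalize tildeP α ζ b₀ (l + 2) k s = B at *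
    generalize tildeP α ζ b₀ (l + 2) (k - 1) s = c at *
    generalize deriv (tildeP α ζ b₀ (l + 1) (k + 1 : ℕ)) s = A' at *
    generalize deriv (tildeP α ζ b₀ (l + 1) k) s = b' at *
    -- at a zero of `a * A - C * b` the quantity `R = B * a - C * c` equals `W * a / b`
    have hR : b * (B * a - C * c) = (b * B - A * c) * a := by linear_combination c * hs
    have hRpos : 0 < B * a - C * c :=
      pos_of_mul_pos_right (hR ▸ mul_pos hW ha) hB.le
    refine pos_of_mul_pos_right (b := 2 * a * A' - 2 * C * b' + α * C * b) (a := b) ?_ hB.le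
    have : b * (2 * a * A' - 2 * C * b' + α * C * b) =
        2 * a * (B * a - C * c) + α * (A * a) * b := by
      linear_combination -2 * a * hab + (2 * b' - α * b) * hs
    rw [this]
    have h1 : 0 < 2 * a * (B * a - C * c) := by positivity
    have h2 : 0 ≤ α * (A * a) * b := by positivity
    linarith

end Dynamics

end GenNovikov

/-! ### The peakon equations -/

namespace GenNovikov

lemma sum_Icc_int_sub {a b : ℤ} (h : a ≤ b + 1) (F : ℤ → ℝ) :
    ∑ j ∈ Finset.Icc a b, (F (j + 1) - F j) = F (b + 1) - F a := by
  obtain ⟨N, hN⟩ : ∃ N : ℕ, b = a + N - 1 := ⟨(b + 1 - a).toNat, by omega⟩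
  subst hN
  induction N with
  | zero => simp
  | succ N ih =>
    have : Finset.Icc a (a + (N + 1 : ℕ) - 1) =
        insert (a + N) (Finset.Icc a (a + N - 1)) := by
      ext j
      simp only [Finset.mem_Icc, Finset.mem_insert]
      omega
    rw [this, Finset.sum_insert (by simp), ih (by omega)]
    push_cast
    ring_nf

section Peakons

variable {n : ℕ} {α : ℝ} {ζ b₀ : Fin n → ℝ}

lemma tildeW_eq_minor (k : ℤ) (t : ℝ) : tildeW α ζ b₀ k t = minor α ζ b₀ 0 k t := by
  simp only [tildeW, tildeV, tildeU, minor, zero_add]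
  ring

/-- The equation for `x = ½ log (Z / W)` with `Z = z²` and `W = w²`, where
`(a, A, b, B, C, c) = (T_k, U_k, U_{k-1}, V_{k-1}, T_{k+1}, V_{k-2})`.  On the right
`z / w * (c / b) + w / z * (a / b)` is the sum of all `m_j e^{-|x_k - x_j|}`; it equals
`(B a - C c) / (z w)`. -/
lemma position_identity {a A b B c C A' b' z w : ℝ} (α : ℝ) (hb : b ≠ 0) (hz : z ≠ 0)
    (hw : w ≠ 0) (hZ : z ^ 2 = a * A - C * b) (hW : w ^ 2 = b * B - A * c)
    (hR : B * a - C * c = A' * b - A * b') :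
    1 / 2 * (((2 * a * A' - 2 * C * b' + α * C * b) * w ^ 2
        - z ^ 2 * (2 * B * b' - 2 * c * A' - α * A * c)) / (w ^ 2) ^ 2 / (z ^ 2 / w ^ 2)) =
      (z / w * (c / b) + w / z * (a / b)) ^ 2
        + α / (2 * (z * w / (A * b))) * (z / w * (c / b) + w / z * (a / b)) - α / 2 := by
  have hu : z / w * (c / b) + w / z * (a / b) = (B * a - C * c) / (z * w) := by
    field_simp
    linear_combination c * hZ + a * hW
  have hnum : (2 * a * A' - 2 * C * b' + α * C * b) * w ^ 2
        - z ^ 2 * (2 * B * b' - 2 * c * A' - α * A * c) =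
      2 * (B * a - C * c) ^ 2 + α * A * b * (B * a - C * c) - α * z ^ 2 * w ^ 2 := by
    rw [hZ, hW]
    linear_combination -2 * (B * a - C * c) * hR
  rw [hu, hnum]
  field_simp

/-- The equation for `m = √(Z W) / (U_k U_{k-1})`, in the notation of `position_identity`. -/
lemma mass_identity {a A b B c C A' b' z w : ℝ} (α : ℝ) (hA : A ≠ 0) (hb : b ≠ 0) (hz : z ≠ 0)
    (hw : w ≠ 0) (hZ : z ^ 2 = a * A - C * b) (hW : w ^ 2 = b * B - A * c)
    (hR : B * a - C * c = A' * b - A * b') :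
    (((2 * a * A' - 2 * C * b' + α * C * b) * w ^ 2
        + z ^ 2 * (2 * B * b' - 2 * c * A' - α * A * c)) / (2 * (z * w)) * (A * b)
        - z * w * (A' * b + A * b')) / (A * b) ^ 2 =
      z * w / (A * b) * (z / w * (c / b) + w / z * (a / b)) * (w / z * (C / A) - z / w * (c / b))
        + α / 2 * (w / z * (C / A) - z / w * (c / b)) := by
  have hu : z / w * (c / b) + w / z * (a / b) = (B * a - C * c) / (z * w) := by
    field_simp
    linear_combination c * hZ + a * hW
  have h1 : 2 * a * A' - 2 * C * b' + α * C * b =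
      (2 * A' * z ^ 2 + C * (2 * (B * a - C * c) + α * A * b)) / A := by
    field_simp
    linear_combination -2 * A' * hZ - 2 * C * hR
  have h2 : 2 * B * b' - 2 * c * A' - α * A * c =
      (2 * b' * w ^ 2 - c * (2 * (B * a - C * c) + α * A * b)) / b := by
    field_simp
    linear_combination -2 * b' * hW + 2 * c * hR
  rw [hu, h1, h2]
  generalize B * a - C * c = R
  field_simp
  ring

end Peakons

end GenNovikov

/-- The positivity clauses of the conclusion say that the logarithms, square roots and quotients
that define `x` and `m` are genuine; the other two are the generalized Novikov peakon system. -/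
theorem mainTheorem11 (n : ℕ) (α : ℝ) (hα : 0 ≤ α) (ζ b₀ : Fin n → ℝ)
    (hζpos : ∀ j, 0 < ζ j) (hζ : StrictMono ζ) (hb : ∀ j, 0 < b₀ j)
    (x m : ℤ → ℝ → ℝ)
    (hx : ∀ k ∈ Finset.Icc (1 : ℤ) n, ∀ t : ℝ,
      x (n + 1 - k) t =
        1 / 2 * Real.log (GenNovikov.tildeZ α ζ b₀ k t / GenNovikov.tildeW α ζ b₀ (k - 1) t))
    (hm : ∀ k ∈ Finset.Icc (1 : ℤ) n, ∀ t : ℝ,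
      m (n + 1 - k) t =
        Real.sqrt (GenNovikov.tildeZ α ζ b₀ k t * GenNovikov.tildeW α ζ b₀ (k - 1) t) /
          (GenNovikov.tildeU α ζ b₀ k t * GenNovikov.tildeU α ζ b₀ (k - 1) t)) :
    ∀ k ∈ Finset.Icc (1 : ℤ) n, ∀ t : ℝ,
      0 < GenNovikov.tildeZ α ζ b₀ k t ∧ 0 < GenNovikov.tildeW α ζ b₀ (k - 1) t ∧
      0 < GenNovikov.tildeU α ζ b₀ k t ∧ 0 < GenNovikov.tildeU α ζ b₀ (k - 1) t ∧
      HasDerivAt (x (n + 1 - k))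
        ((GenNovikov.sumBelow n x m k t + GenNovikov.sumFrom n x m k k t) ^ 2
          + α / (2 * m (n + 1 - k) t) *
              (GenNovikov.sumBelow n x m k t + GenNovikov.sumFrom n x m k k t)
          - α / 2) t ∧
      HasDerivAt (m (n + 1 - k))
        (m (n + 1 - k) t *
            (GenNovikov.sumBelow n x m k t + GenNovikov.sumFrom n x m k k t) *
            (GenNovikov.sumFrom n x m (k + 1) k t - GenNovikov.sumBelow n x m k t)
          + α / 2 * (GenNovikov.sumFrom n x m (k + 1) k t - GenNovikov.sumBelow n x m k t)) t := by
  open GenNovikov in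
  have hU : ∀ j ∈ Finset.Icc (0 : ℤ) n, ∀ t, 0 < tildeU α ζ b₀ j t := by
    intro j hj t
    obtain ⟨h0, h1⟩ := Finset.mem_Icc.1 hj
    lift j to ℕ using h0
    exact tildeP_pos hα hζpos hζ hb 0 (by exact_mod_cast h1) t
  have hZ : ∀ j ∈ Finset.Icc (1 : ℤ) n, ∀ t, 0 < tildeZ α ζ b₀ j t := by
    intro j hj t
    obtain ⟨h0, h1⟩ := Finset.mem_Icc.1 hj
    lift j to ℕ using by omega
    exact minor_pos hα hζpos hζ hb (by exact_mod_cast h1) (-1) t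
  have hW : ∀ j ∈ Finset.Icc (1 : ℤ) n, ∀ t, 0 < tildeW α ζ b₀ (j - 1) t := by
    intro j hj t
    obtain ⟨h0, h1⟩ := Finset.mem_Icc.1 hj
    rw [tildeW_eq_minor]
    obtain ⟨i, hi⟩ : ∃ i : ℕ, j - 1 = i := ⟨(j - 1).toNat, by omega⟩
    rw [hi]
    exact minor_pos hα hζpos hζ hb (by omega) 0 t
  have hexp : ∀ j ∈ Finset.Icc (1 : ℤ) n, ∀ t, Real.exp (x (n + 1 - j) t) =
      √(tildeZ α ζ b₀ j t) / √(tildeW α ζ b₀ (j - 1) t) := by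
    intro j hj t
    rw [hx j hj, ← Real.sqrt_div (hZ j hj t).le, Real.sqrt_eq_rpow,
      Real.rpow_def_of_pos (div_pos (hZ j hj t) (hW j hj t)), mul_comm]
  have hm' : ∀ j ∈ Finset.Icc (1 : ℤ) n, ∀ t, m (n + 1 - j) t =
      √(tildeZ α ζ b₀ j t) * √(tildeW α ζ b₀ (j - 1) t) /
        (tildeU α ζ b₀ j t * tildeU α ζ b₀ (j - 1) t) := by
    intro j hj t
    rw [hm j hj, Real.sqrt_mul (hZ j hj t).le]
  -- both sums telescope, because `W_{j-1} / (U_j U_{j-1})` and `Z_j / (U_j U_{j-1})` are differences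
  have hbelow : ∀ k ∈ Finset.Icc (1 : ℤ) n, ∀ t, sumBelow n x m k t =
      √(tildeZ α ζ b₀ k t) / √(tildeW α ζ b₀ (k - 1) t) *
        (tildeV α ζ b₀ (k - 2) t / tildeU α ζ b₀ (k - 1) t) := by
    intro k hk t
    obtain ⟨hk1, hkn⟩ := Finset.mem_Icc.1 hk
    let F : ℤ → ℝ := fun j => tildeV α ζ b₀ (j - 2) t / tildeU α ζ b₀ (j - 1) t
    have hterm : ∀ j ∈ Finset.Icc (1 : ℤ) (k - 1),
        m (n + 1 - j) t * Real.exp (x (n + 1 - k) t - x (n + 1 - j) t) =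
        √(tildeZ α ζ b₀ k t) / √(tildeW α ζ b₀ (k - 1) t) * (F (j + 1) - F j) := by
      intro j hj
      obtain ⟨hj1, hjn⟩ := Finset.mem_Icc.1 hj
      have hj' : j ∈ Finset.Icc (1 : ℤ) n := Finset.mem_Icc.2 ⟨hj1, by omega⟩
      have u1 := (hU j (Finset.mem_Icc.2 ⟨by omega, by omega⟩) t).ne'
      have u2 := (hU (j - 1) (Finset.mem_Icc.2 ⟨by omega, by omega⟩) t).ne'
      have z1 := (Real.sqrt_pos.2 (hZ j hj' t)).ne'
      have w1 := (Real.sqrt_pos.2 (hW j hj' t)).ne'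
      have w2 := Real.sq_sqrt (hW j hj' t).le
      have hF : F (j + 1) - F j = √(tildeW α ζ b₀ (j - 1) t) ^ 2 /
          (tildeU α ζ b₀ j t * tildeU α ζ b₀ (j - 1) t) := by
        rw [w2]
        simp only [F, tildeW, show j + 1 - 2 = j - 1 by ring, show j + 1 - 1 = j by ring,
          show j - 1 - 1 = j - 2 by ring, show j - 1 + 1 = j by ring]
        field_simp
      rw [hF, hm' j hj', Real.exp_sub, hexp k hk, hexp j hj']
      field_simp
    rw [sumBelow, Finset.sum_congr rfl hterm, ← Finset.mul_sum, sum_Icc_int_sub (by omega)]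
    simp only [F, show k - 1 + 1 - 2 = k - 2 by ring, show k - 1 + 1 - 1 = k - 1 by ring]
    rw [show tildeV α ζ b₀ (1 - 2) t = 0 from tildeP_neg 1 (by norm_num) t, zero_div, sub_zero]
  have hfrom : ∀ k ∈ Finset.Icc (1 : ℤ) n, ∀ t, ∀ i ∈ Finset.Icc (1 : ℤ) (n + 1),
      sumFrom n x m i k t = √(tildeW α ζ b₀ (k - 1) t) / √(tildeZ α ζ b₀ k t) *
        (tildeT α ζ b₀ i t / tildeU α ζ b₀ (i - 1) t) := by
    intro k hk t i hi
    obtain ⟨hi1, hin⟩ := Finset.mem_Icc.1 hi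
    let F : ℤ → ℝ := fun j => -(tildeT α ζ b₀ j t / tildeU α ζ b₀ (j - 1) t)
    have hterm : ∀ j ∈ Finset.Icc i (n : ℤ),
        m (n + 1 - j) t * Real.exp (x (n + 1 - j) t - x (n + 1 - k) t) =
        √(tildeW α ζ b₀ (k - 1) t) / √(tildeZ α ζ b₀ k t) * (F (j + 1) - F j) := by
      intro j hj
      obtain ⟨hj1, hjn⟩ := Finset.mem_Icc.1 hj
      have hj' : j ∈ Finset.Icc (1 : ℤ) n := Finset.mem_Icc.2 ⟨by omega, hjn⟩
      have u1 := (hU j (Finset.mem_Icc.2 ⟨by omega, by omega⟩) t).ne'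
      have u2 := (hU (j - 1) (Finset.mem_Icc.2 ⟨by omega, by omega⟩) t).ne'
      have w1 := (Real.sqrt_pos.2 (hW j hj' t)).ne'
      have z2 := Real.sq_sqrt (hZ j hj' t).le
      have hF : F (j + 1) - F j = √(tildeZ α ζ b₀ j t) ^ 2 /
          (tildeU α ζ b₀ j t * tildeU α ζ b₀ (j - 1) t) := by
        rw [z2]
        simp only [F, tildeZ, show j + 1 - 1 = j by ring]
        field_simp
        ring
      rw [hF, hm' j hj', Real.exp_sub, hexp k hk, hexp j hj']
      field_simp
    rw [sumFrom, Finset.sum_congr rfl hterm, ← Finset.mul_sum, sum_Icc_int_sub (by omega)]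
    have hT : tildeT α ζ b₀ (n + 1) t = 0 :=
      tildeP_eq_zero hα hζpos hζ (-1) (k := n + 1) (by omega) t
    simp only [F, hT, zero_div, neg_zero, zero_sub, neg_neg]
  intro k hk t
  obtain ⟨hk1, hkn⟩ := Finset.mem_Icc.1 hk
  have hUk : ∀ t, 0 < tildeU α ζ b₀ k t := hU k (Finset.mem_Icc.2 ⟨by omega, hkn⟩)
  have hUk' : ∀ t, 0 < tildeU α ζ b₀ (k - 1) t :=
    hU (k - 1) (Finset.mem_Icc.2 ⟨by omega, by omega⟩)
  refine ⟨hZ k hk t, hW k hk t, hUk t, hUk' t, ?_⟩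
  have hx' : x (n + 1 - k) = fun t => 1 / 2 * Real.log
      (tildeZ α ζ b₀ k t / tildeW α ζ b₀ (k - 1) t) := funext (hx k hk)
  have hm'' : m (n + 1 - k) = fun t => √(tildeZ α ζ b₀ k t * tildeW α ζ b₀ (k - 1) t) /
      (tildeU α ζ b₀ k t * tildeU α ζ b₀ (k - 1) t) := funext (hm k hk)
  have dZ : HasDerivAt (tildeZ α ζ b₀ k) _ t :=
    hasDerivAt_minor (b₀ := b₀) hα hζpos hζ (-1) (k := k) (by omega) t
  have dW : HasDerivAt (tildeW α ζ b₀ (k - 1)) _ t :=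
    (hasDerivAt_minor' (b₀ := b₀) hα hζpos hζ 0 (k := k - 1) (by omega) t).congr_of_eventuallyEq
      (Filter.Eventually.of_forall fun t => tildeW_eq_minor (k - 1) t)
  have dA := tildeP_hasDerivAt_deriv (b₀ := b₀) hα hζpos hζ 0 k t
  have db := tildeP_hasDerivAt_deriv (b₀ := b₀) hα hζpos hζ 0 (k - 1) t
  have hR := bilinear_three (b₀ := b₀) hα hζpos hζ (-1) hk1 t
  have hzp := Real.sqrt_pos.2 (hZ k hk t)
  have hwp := Real.sqrt_pos.2 (hW k hk t)
  have hz2 := Real.sq_sqrt (hZ k hk t).le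
  have hw2 := Real.sq_sqrt (hW k hk t).le
  have hz3 : √(tildeZ α ζ b₀ k t) ^ 2 = tildeP α ζ b₀ (-1) k t * tildeP α ζ b₀ 0 k t
      - tildeP α ζ b₀ (-1) (k + 1) t * tildeP α ζ b₀ 0 (k - 1) t := hz2
  have hw3 : √(tildeW α ζ b₀ (k - 1) t) ^ 2 = tildeP α ζ b₀ 0 (k - 1) t * tildeP α ζ b₀ 1 (k - 1) t
      - tildeP α ζ b₀ 0 k t * tildeP α ζ b₀ 1 (k - 2) t := by
    rw [hw2, tildeW_eq_minor, minor, show k - 1 + 1 = k by ring, show k - 1 - 1 = k - 2 by ring,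
      zero_add]
  rw [show k - 1 + 1 = k by ring, show k - 1 - 1 = k - 2 by ring, zero_add] at dW
  rw [show (-1 : ℤ) + 1 = 0 by norm_num] at dZ
  rw [show (-1 : ℤ) + 1 = 0 by norm_num, show (-1 : ℤ) + 2 = 1 by norm_num] at hR
  have hA : tildeP α ζ b₀ 0 k t ≠ 0 := (hUk t).ne'
  have hb' : tildeP α ζ b₀ 0 (k - 1) t ≠ 0 := (hUk' t).ne'
  rw [hbelow k hk t, hfrom k hk t k (Finset.mem_Icc.2 ⟨hk1, by omega⟩),
    hfrom k hk t (k + 1) (Finset.mem_Icc.2 ⟨by omega, by omega⟩), hm' k hk t,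
    show k + 1 - 1 = k by ring]
  constructor
  · rw [hx']
    refine (((dZ.div dW (hW k hk t).ne').log
      (div_pos (hZ k hk t) (hW k hk t)).ne').const_mul (1 / 2)).congr_deriv ?_
    refine Eq.trans ?_ (position_identity α hb' hzp.ne' hwp.ne' hz3 hw3 hR)
    rw [hz2, hw2]
    rfl
  · rw [hm'']
    refine (((dZ.mul dW).sqrt (mul_pos (hZ k hk t) (hW k hk t)).ne').div (dA.mul db)
      (mul_pos (hUk t) (hUk' t)).ne').congr_deriv ?_
    refine Eq.trans ?_ (mass_identity α hA hb' hzp.ne' hwp.ne' hz3 hw3 hR)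
    rw [hz2, hw2, ← Real.sqrt_mul (hZ k hk t).le]
    rfl
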